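/- **Conventions.** Morphisms are composed from left to right. A *category with subobjects* is a small category $\mathcal C$ (object set $v\mathcal C$) with a subcategory $\mathcal P$, $v\mathcal P=v\mathcal C$, that is a strict preorder (at most one morphism between two objects, only identities as isomorphisms), all of whose morphisms (*inclusions* $j(c',c)\colon c'\to c$; one writes $c'\subseteq c$) are monomorphisms in $\mathcal C$, and such that $f=hg$ with $f,g\in\mathcal P$ implies $h\in\mathcal P$. A *retraction* is a right inverse $q$ of an inclusion, $j(c',c)q=1_{c'}$. A *normal cone* with apex $d$ is a family of morphisms $\gamma(c)\colon c\to d$ $(c\in v\mathcal C)$ with $j(c,c')\gamma(c')=\gamma(c)$ whenever $c\subseteq c'$, at least one $\gamma(c)$ being an isomorphism; the apex is denoted $c_\gamma$. $\mathcal C$ is *normal* if every morphism is a product $f=quj$ of a retraction, an isomorphism and an inclusion, every inclusion splits, and every object $c$ is the apex of a normal cone with $\gamma(c)=1_c$. In a normal category $f^\circ=qu$ depends only on $f$, and for a normal cone $\gamma$ and $f\colon c_\gamma\to c$ the components $\gamma(a)f^\circ$ form a normal cone $\gamma*f^\circ$. The *$H$-functor* $H(\gamma;-)\colon\mathcal C\to\mathbf{Set}$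 is $H(\gamma;c)=\{\gamma*f^\circ: f\in\mathcal C(c_\gamma,c)\}$, $H(\gamma;g)\colon\gamma*f^\circ\mapsto\gamma*(fg)^\circ$, and $\eta_\gamma\colon H(\gamma;-)\to\mathcal C(c_\gamma,-)$, $\gamma*f^\circ\mapsto f$, is a natural isomorphism. The *normal dual* $N^*\mathcal C$ is the full subcategory of $[\mathcal C,\mathbf{Set}]$ on the $H$-functors; its inclusions are the natural transformations all of whose components are inclusions of sets. The *ideal* $\langle c\rangle$ is the full subcategory on the objects $d\subseteq c$. A functor $F\colon\mathcal C\to\mathcal D$ between normal categories is a *local isomorphism* if it maps inclusions to inclusions, is fully faithful, and for each $c\in v\mathcal C$ restricts to an isomorphism (bijective on objects and fully faithful) of $\langle c\rangle$ onto $\langle F(c)\rangle$. **The categories.** Let $S$ be a regular semigroup with set of idempotents $E$. For $e,f\in E$ put $e\,\omega^l f\iff ef=e$, $e\,\omega^r f\iff fe=e$, $\omega=\omega^l\cap\omega^r$, $\mathscr L=\omega^l\cap(\omega^l)^{-1}$, $\mathscr R=\omega^r\cap(\omega^r)^{-1}$. The inductive groupoid $\mathcal G(S)$ has object set $E$ and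 as morphisms from $e$ to $f$ the pairs $(x,x')$ of mutually inverse elements ($xx'x=x$, $x'xx'=x'$) with $xx'=e$, $x'x=f$. The category $\mathcal L_G$ has object set $E/\mathscr L$ (class of $e$: $\overleftarrow e$). Its morphisms are generated by the arrows $r(e,e,f)\colon\overleftarrow e\to\overleftarrow f$ with $e\,\omega^l f$ (the inclusions), $r(e,u,f)$ with $u\in E$, $u\,\mathscr L\, f$, $u\,\omega\, e$, and $r(e,x,f)$ with $(x,x')\in\mathcal G(S)$ from $e$ to $f$, under the composition $r(e,u,f)\,r(g,v,h)=r(e,uv,h)$ for $f\,\mathscr L\,g$, where $r(e,u,f)$ and $r(g,v,h)$ are identified if and only if $e\,\mathscr L\,g$, $f\,\mathscr L\,h$ and $u=ev$; thus the morphisms $\overleftarrow e\to\overleftarrow f$ are the $r(e,u,f)$ with $u\in eSf$. Dually $\mathcal R_G$ has object set $E/\mathscr R$ (class of $e$: $\overrightarrow e$). Its morphisms are generated by the arrows $l(e,e,f)\colon\overrightarrow e\to\overrightarrow f$ with $e\,\omega^r f$ (the inclusions), $l(e,u,f)$ with $u\in E$, $u\,\mathscr R\,f$, $u\,\omega\,e$,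 and $l(e,x',f)$ with $(x,x')\in\mathcal G(S)$ from $e$ to $f$, under the composition $l(e,u,f)\,l(g,v,h)=l(e,vu,h)$ for $f\,\mathscr R\,g$, where $l(e,u,f)$ and $l(g,v,h)$ are identified if and only if $e\,\mathscr R\,g$, $f\,\mathscr R\,h$ and $u=ve$; thus the morphisms $\overrightarrow e\to\overrightarrow f$ are the $l(e,u,f)$ with $u\in fSe$. The category $\mathcal L_G$ is normal. For $e\in E$ let $r^e$ be the normal cone in $\mathcal L_G$ with apex $\overleftarrow e$ and components $r^e(\overleftarrow g)=r(g,ge,e)$. Let $\Gamma_G\colon\mathcal R_G\to N^*\mathcal L_G$ be the functor $$\Gamma_G(\overrightarrow e)=H(r^e;-),\qquad \Gamma_G(l(e,u,f))=\eta_{r^e}\;\mathcal L_G(r(f,u,e),-)\;\eta_{r^f}^{-1}.$$ **Proposition.** For every regular semigroup $S$, the functor $\Gamma_G$ is a local isomorphism: $\mathcal R_G$ and $N^*\mathcal L_G$ are normal categories, $\Gamma_G$ maps inclusions to inclusions, it is fully faithful, and for every object $c$ of $\mathcal R_G$ it restricts to an isomorphism of the ideal $\langle c\rangle$ onto the ideal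 $\langle\Gamma_G(c)\rangle$. -/

import Mathlib

open CategoryTheory

universe u

namespace CrossConn

/-! ### Categories with subobjects and normal categories -/

/-- A small category `C` with a choice of subobjects: a wide subcategory of "inclusions" which is a
strict preorder, all of whose morphisms are monomorphisms of `C`, and such that `f = h ≫ g` with
`f`, `g` inclusions forces `h` to be an inclusion. -/
class CategoryWithSubobjects (C : Type u) [SmallCategory C] where
  /-- `Incl f` says that `f` is an inclusion. -/
  Incl : ∀ {a b : C}, (a ⟶ b) → Prop
  id_mem : ∀ c : C, Incl (𝟙 c)
  comp_mem : ∀ {a b c : C} (f : a ⟶ b) (g : b ⟶ c), Incl f → Incl g → Incl (f ≫ g)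
  /-- There is at most one inclusion from one object to another. -/
  unique : ∀ {a b : C} (f g : a ⟶ b), Incl f → Incl g → f = g
  /-- The preorder is strict. -/
  antisymm : ∀ {a b : C} (f : a ⟶ b) (g : b ⟶ a), Incl f → Incl g → a = b
  mono : ∀ {a b : C} (f : a ⟶ b), Incl f → Mono f
  left_mem : ∀ {a b c : C} (h : a ⟶ b) (g : b ⟶ c), Incl g → Incl (h ≫ g) → Incl h

open CategoryWithSubobjects

section Normal

variable {C : Type u} [SmallCategory C] [CategoryWithSubobjects C]

/-- `a ⊆ b`: there is an inclusion from `a` to `b`. -/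
def IsSub (a b : C) : Prop := ∃ j : a ⟶ b, Incl j

/-- A retraction is a morphism that splits an inclusion. -/
def IsRetraction {a b : C} (q : a ⟶ b) : Prop := ∃ j : b ⟶ a, Incl j ∧ j ≫ q = 𝟙 b

/-- A normal factorization `f = q u j`: a retraction, followed by an isomorphism, followed by an
inclusion. -/
structure NormalFactorization {c d : C} (f : c ⟶ d) where
  c' : C
  d' : C
  q : c ⟶ c'
  u : c' ⟶ d'
  j : d' ⟶ d
  isRetraction_q : IsRetraction q
  isIso_u : IsIso u
  incl_j : Incl j
  fac : q ≫ u ≫ j = f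

/-- `γ` is a normal cone with apex `d`. -/
structure IsNormalCone {d : C} (γ : ∀ c : C, c ⟶ d) : Prop where
  incl_comp : ∀ {c c' : C} (j : c ⟶ c'), Incl j → j ≫ γ c' = γ c
  exists_isIso : ∃ c : C, IsIso (γ c)

variable (C) in
/-- A normal category. -/
class IsNormalCategory : Prop where
  exists_factorization : ∀ {c d : C} (f : c ⟶ d), Nonempty (NormalFactorization f)
  incl_splits : ∀ {c c' : C} (j : c ⟶ c'), Incl j → ∃ q : c' ⟶ c, j ≫ q = 𝟙 c
  exists_cone : ∀ c : C, ∃ γ : (∀ a : C, a ⟶ c), IsNormalCone γ ∧ γ c = 𝟙 c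

variable (C) in
/-- The set of all normal cones of `C` (the underlying set of the semigroup `TC`). -/
structure NormalCone where
  apex : C
  comp : ∀ c : C, c ⟶ apex
  isNormal : IsNormalCone comp

/-- Two normal cones coincide as soon as they do so after composition with inclusions of their
apices into a common object. -/
theorem NormalCone.ext_of_incl (α β : NormalCone C) {c : C} (i : α.apex ⟶ c) (j : β.apex ⟶ c)
    (hi : Incl i) (hj : Incl j) (h : ∀ k, α.comp k ≫ i = β.comp k ≫ j) : α = β := by
  obtain ⟨a, α, hα⟩ := α
  obtain ⟨b, β, hβ⟩ := β
  dsimp only at i j h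
  obtain ⟨k, hk⟩ := hα.exists_isIso
  obtain ⟨l, hl⟩ := hβ.exists_isIso
  have h1 : Incl (inv (α k) ≫ β k) := by
    refine left_mem _ j hj ?_
    rw [Category.assoc, ← h k, IsIso.inv_hom_id_assoc]; exact hi
  have h2 : Incl (inv (β l) ≫ α l) := by
    refine left_mem _ i hi ?_
    rw [Category.assoc, h l, IsIso.inv_hom_id_assoc]; exact hj
  obtain rfl := antisymm _ _ h1 h2
  obtain rfl := unique _ _ hi hj
  have := mono i hi
  congr 1
  funext m
  exact (cancel_mono i).1 (h m)

theorem NormalFactorization.splitEpi {c d : C} {f : c ⟶ d} (F : NormalFactorization f) :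
    ∃ s : F.d' ⟶ c, s ≫ F.q ≫ F.u = 𝟙 _ := by
  obtain ⟨j, -, hj⟩ := F.isRetraction_q
  have := F.isIso_u
  exact ⟨inv F.u ≫ j, by rw [Category.assoc, reassoc_of% hj, IsIso.inv_hom_id]⟩

/-- The epimorphic component of a morphism is the same for all its normal factorizations. -/
theorem NormalFactorization.epi_unique {c d : C} {f : c ⟶ d} (F G : NormalFactorization f) :
    F.d' = G.d' ∧ HEq (F.q ≫ F.u) (G.q ≫ G.u) := by
  obtain ⟨s, hs⟩ := F.splitEpi
  obtain ⟨t, ht⟩ := G.splitEpi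
  have e : (F.q ≫ F.u) ≫ F.j = (G.q ≫ G.u) ≫ G.j := by
    rw [Category.assoc, Category.assoc, F.fac, G.fac]
  have h1 : Incl (s ≫ G.q ≫ G.u) := by
    refine left_mem _ G.j G.incl_j ?_
    rw [Category.assoc, ← e, ← Category.assoc, hs, Category.id_comp]; exact F.incl_j
  have h2 : Incl (t ≫ F.q ≫ F.u) := by
    refine left_mem _ F.j F.incl_j ?_
    rw [Category.assoc, e, ← Category.assoc, ht, Category.id_comp]; exact G.incl_j
  have hd := antisymm _ _ h1 h2
  refine ⟨hd, ?_⟩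
  obtain ⟨c1, d1, q1, u1, j1, hq1, hu1, hj1, f1⟩ := F
  obtain ⟨c2, d2, q2, u2, j2, hq2, hu2, hj2, f2⟩ := G
  dsimp only at *
  subst hd
  obtain rfl := unique _ _ hj1 hj2
  have := mono j1 hj1
  exact heq_of_eq ((cancel_mono j1).1 e)

variable [IsNormalCategory C]

/-- A chosen normal factorization; the epimorphic component does not depend on the choice, see
`NormalFactorization.epi_unique`. -/
noncomputable def normalFact {c d : C} (f : c ⟶ d) : NormalFactorization f :=
  Classical.choice (IsNormalCategory.exists_factorization f)

/-- The codomain of the epimorphic component of `f`. -/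
noncomputable def im {c d : C} (f : c ⟶ d) : C := (normalFact f).d'

/-- The epimorphic component `f° = q u` of a morphism `f = q u j`. -/
noncomputable def epiComp {c d : C} (f : c ⟶ d) : c ⟶ im f := (normalFact f).q ≫ (normalFact f).u

/-- The inclusion of the codomain of `f°` into the codomain of `f`. -/
noncomputable def imIncl {c d : C} (f : c ⟶ d) : im f ⟶ d := (normalFact f).j

theorem incl_imIncl {c d : C} (f : c ⟶ d) : Incl (imIncl f) := (normalFact f).incl_j

theorem epiComp_imIncl {c d : C} (f : c ⟶ d) : epiComp f ≫ imIncl f = f := by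
  exact (Category.assoc _ _ _).trans (normalFact f).fac

instance epi_epiComp {c d : C} (f : c ⟶ d) : Epi (epiComp f) := by
  obtain ⟨s, hs⟩ := (normalFact f).splitEpi
  exact (SplitEpi.mk s hs).epi

/-- If `γ` is a normal cone and `f` is an epimorphism from its apex, the cone with components
`γ(a) f` is normal. -/
theorem isNormalCone_star {b d : C} {γ : ∀ c : C, c ⟶ b} (hγ : IsNormalCone γ) (f : b ⟶ d)
    [Epi f] : IsNormalCone (fun a => γ a ≫ f) := by
  refine ⟨fun j hj => by rw [← Category.assoc, hγ.incl_comp j hj], ?_⟩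
  obtain ⟨c, hc⟩ := hγ.exists_isIso
  obtain ⟨⟨b', d', q, u, j, ⟨i, hi, hiq⟩, hu, hj, fac⟩⟩ := IsNormalCategory.exists_factorization f
  -- `j` is an isomorphism
  have hjiso : IsIso j := by
    obtain ⟨r, hr⟩ := IsNormalCategory.incl_splits j hj
    have : Epi j := by
      have h1 : Epi ((q ≫ u) ≫ j) := by rw [Category.assoc, fac]; infer_instance
      exact epi_of_epi (q ≫ u) j
    refine ⟨r, hr, ?_⟩
    rw [← cancel_epi j, reassoc_of% hr, Category.comp_id]
  -- a subobject of `c` isomorphic to `b'` through `γ c`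
  obtain ⟨⟨x, y, q', v, k, ⟨i', hi', hiq'⟩, hv, hk, fac'⟩⟩ :=
    IsNormalCategory.exists_factorization (i ≫ inv (γ c))
  have hmono := mono i hi
  have hq'iso : IsIso q' := by
    have h1 : Mono q' := by
      have : Mono (q' ≫ v ≫ k) := by rw [fac']; infer_instance
      exact mono_of_mono q' (v ≫ k)
    refine ⟨i', ?_, hiq'⟩
    rw [← cancel_mono q', Category.assoc, hiq', Category.comp_id, Category.id_comp]
  refine ⟨y, ?_⟩
  have e1 : γ y = inv (q' ≫ v) ≫ i := by
    rw [← hγ.incl_comp k hk, IsIso.eq_inv_comp, ← Category.assoc, Category.assoc q', fac',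
      Category.assoc, IsIso.inv_hom_id, Category.comp_id]
  have e2 : γ y ≫ f = inv (q' ≫ v) ≫ u ≫ j := by
    rw [e1, ← fac, Category.assoc, reassoc_of% hiq]
  rw [e2]
  infer_instance

/-- The normal cone `γ ∗ f`, for an epimorphism `f` from the apex of `γ`. -/
def NormalCone.star (γ : NormalCone C) {d : C} (f : γ.apex ⟶ d) [Epi f] : NormalCone C where
  apex := d
  comp a := γ.comp a ≫ f
  isNormal := isNormalCone_star γ.isNormal f

/-- The cone `γ ∗ f°`, for any morphism `f` from the apex of `γ`. -/
noncomputable def NormalCone.starEpi (γ : NormalCone C) {d : C} (f : γ.apex ⟶ d) : NormalCone C :=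
  γ.star (epiComp f)

theorem starEpi_comp_imIncl (γ : NormalCone C) {d : C} (f : γ.apex ⟶ d) (k : C) :
    (γ.starEpi f).comp k ≫ imIncl f = γ.comp k ≫ f :=
  (Category.assoc _ _ _).trans (congrArg _ (epiComp_imIncl f))

theorem starEpi_eq_iff (γ δ : NormalCone C) {d : C} (f : γ.apex ⟶ d) (g : δ.apex ⟶ d) :
    γ.starEpi f = δ.starEpi g ↔ ∀ k, γ.comp k ≫ f = δ.comp k ≫ g := by
  constructor
  · intro h k
    rw [← starEpi_comp_imIncl, ← starEpi_comp_imIncl]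
    have key : ∀ (α β : NormalCone C) (i : α.apex ⟶ d) (j : β.apex ⟶ d), Incl i → Incl j → α = β →
        α.comp k ≫ i = β.comp k ≫ j := by
      rintro α _ i j hi hj rfl
      rw [unique _ _ hi hj]
    exact key _ _ (imIncl f) (imIncl g) (incl_imIncl f) (incl_imIncl g) h
  · intro h
    refine NormalCone.ext_of_incl _ _ (imIncl f) (imIncl g) (incl_imIncl f) (incl_imIncl g) ?_
    intro k
    rw [starEpi_comp_imIncl, starEpi_comp_imIncl, h]

theorem starEpi_injective (γ : NormalCone C) (d : C) :
    Function.Injective (fun f : γ.apex ⟶ d => γ.starEpi f) := by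
  intro f g h
  obtain ⟨c, hc⟩ := γ.isNormal.exists_isIso
  exact (cancel_epi (γ.comp c)).1 ((starEpi_eq_iff γ γ f g).1 h c)

end Normal

/-! ### Set-valued functors, `H`-functors and the normal dual -/

/-- The category of subsets of a set `X` and all functions between them: a full subcategory of the
category of sets. -/
structure SubsetCat (X : Type u) where
  carrier : Set X

instance (X : Type u) : SmallCategory (SubsetCat X) where
  Hom A B := A.carrier → B.carrier
  id A := fun x => x
  comp f g := fun x => g (f x)

/-- The inclusion of `SubsetCat X` into the category of sets. -/
def SubsetCat.toType (X : Type u) : SubsetCat X ⥤ Type u where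
  obj A := A.carrier
  map f := TypeCat.ofHom f

/-- A natural transformation between functors with values in subsets of `X`, obtained from one
between the same functors regarded as set-valued functors. -/
def SubsetCat.liftTrans {C : Type u} [SmallCategory C] {X : Type u} {F G : C ⥤ SubsetCat X}
    (t : F ⋙ SubsetCat.toType X ⟶ G ⋙ SubsetCat.toType X) : F ⟶ G where
  app c := fun x => (t.app c) x
  naturality c d f := by
    funext x
    exact congrArg (fun (φ : (F ⋙ SubsetCat.toType X).obj c ⟶ (G ⋙ SubsetCat.toType X).obj d) =>
      φ x) (t.naturality f)

theorem SubsetCat.functor_ext {C : Type u} [SmallCategory C] {X : Type u} {F G : C ⥤ SubsetCat X}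
    (hobj : ∀ c, (F.obj c).carrier = (G.obj c).carrier)
    (hmap : ∀ (c d : C) (g : c ⟶ d) (x : X) (hx : x ∈ (F.obj c).carrier)
      (hx' : x ∈ (G.obj c).carrier),
      ((F.map g : (F.obj c).carrier → (F.obj d).carrier) ⟨x, hx⟩ : X) =
        (G.map g : (G.obj c).carrier → (G.obj d).carrier) ⟨x, hx'⟩) : F = G := by
  obtain ⟨Fo, Fm, hF1, hF2⟩ := F
  obtain ⟨Go, Gm, hG1, hG2⟩ := G
  dsimp only at hobj hmap
  have h : Fo = Go := funext fun c => congrArg SubsetCat.mk (hobj c)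
  subst h
  have h : @Fm = @Gm := by
    funext c d g x
    exact Subtype.ext (hmap c d g x.1 x.2 x.2)
  subst h
  rfl

section Dual

variable {C : Type u} [SmallCategory C] [CategoryWithSubobjects C] [IsNormalCategory C]

/-- The set `H(γ; c) = {γ ∗ f° : f ∈ C(c_γ, c)}`. -/
def Hset (γ : NormalCone C) (c : C) : Set (NormalCone C) :=
  {α | ∃ f : γ.apex ⟶ c, γ.starEpi f = α}

/-- The bijection `γ ∗ f° ↦ f` from `H(γ; c)` to `C(c_γ, c)`. -/
noncomputable def HsetEquiv (γ : NormalCone C) (c : C) : Hset γ c ≃ (γ.apex ⟶ c) :=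
  (Equiv.ofBijective (fun f : γ.apex ⟶ c => (⟨γ.starEpi f, f, rfl⟩ : Hset γ c))
    ⟨fun _ _ h => starEpi_injective γ c (congrArg Subtype.val h),
      fun ⟨_, f, hf⟩ => ⟨f, Subtype.ext hf⟩⟩).symm

theorem HsetEquiv_symm_coe (γ : NormalCone C) (c : C) (f : γ.apex ⟶ c) :
    ((HsetEquiv γ c).symm f : NormalCone C) = γ.starEpi f := rfl

/-- The `H`-functor `H(γ; -)`: it maps `g : c ⟶ d` to `γ ∗ f° ↦ γ ∗ (f g)°`. -/
noncomputable def Hfunctor (γ : NormalCone C) : C ⥤ SubsetCat (NormalCone C) where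
  obj c := ⟨Hset γ c⟩
  map {c d} g := fun α => (HsetEquiv γ d).symm (HsetEquiv γ c α ≫ g)
  map_id c := by
    funext α
    simp only [Category.comp_id, Equiv.symm_apply_apply]
    rfl
  map_comp f g := by
    funext α
    change _ = (HsetEquiv γ _).symm (HsetEquiv γ _ ((HsetEquiv γ _).symm _) ≫ g)
    rw [Equiv.apply_symm_apply, Category.assoc]

theorem Hfunctor_map_starEpi (γ : NormalCone C) {c d : C} (f : γ.apex ⟶ c) (g : c ⟶ d) :
    (((Hfunctor γ).map g : Hset γ c → Hset γ d) ⟨γ.starEpi f, f, rfl⟩ : NormalCone C) =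
      γ.starEpi (f ≫ g) := by
  change γ.starEpi (HsetEquiv γ c ((HsetEquiv γ c).symm f) ≫ g) = _
  rw [Equiv.apply_symm_apply]

/-- The natural isomorphism `η_γ : H(γ; -) ⟶ C(c_γ, -)`, `γ ∗ f° ↦ f`. -/
noncomputable def eta (γ : NormalCone C) :
    Hfunctor γ ⋙ SubsetCat.toType (NormalCone C) ≅ coyoneda.obj (Opposite.op γ.apex) :=
  NatIso.ofComponents (fun c => (HsetEquiv γ c).toIso) (by
    intro c d g
    ext α
    exact (HsetEquiv γ d).apply_symm_apply _)

variable (C) in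
/-- The normal dual `N*C`: the full subcategory of the category of set-valued functors on `C` (and
natural transformations) whose objects are the `H`-functors. All values of `H`-functors are subsets
of the set of normal cones. -/
abbrev NormalDual : Type u :=
  ObjectProperty.FullSubcategory
    (fun F : C ⥤ SubsetCat (NormalCone C) => ∃ γ : NormalCone C, Hfunctor γ = F)

/-- `H(γ; -)` as an object of the normal dual. -/
noncomputable def Hobj (γ : NormalCone C) : NormalDual C := ⟨Hfunctor γ, γ, rfl⟩

/-- The component at `c` of a morphism of the normal dual, as a function. -/
def NormalDual.app {F G : NormalDual C} (t : F ⟶ G) (c : C) :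
    (F.obj.obj c).carrier → (G.obj.obj c).carrier := t.hom.app c

theorem NormalDual.hom_ext' {F G : NormalDual C} {s t : F ⟶ G}
    (h : ∀ c x, (NormalDual.app s c x : NormalCone C) = NormalDual.app t c x) : s = t := by
  apply ObjectProperty.hom_ext
  apply NatTrans.ext
  funext c
  funext x
  exact Subtype.ext (h c x)

/-- Inclusions of the normal dual: natural transformations all of whose components are inclusions
of sets. -/
def NormalDual.IsIncl {F G : NormalDual C} (t : F ⟶ G) : Prop :=
  ∀ (c : C) (x : (F.obj.obj c).carrier), (NormalDual.app t c x : NormalCone C) = x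

theorem NormalDual.app_comp {F G K : NormalDual C} (s : F ⟶ G) (t : G ⟶ K) (c : C)
    (x : (F.obj.obj c).carrier) :
    NormalDual.app (s ≫ t) c x = NormalDual.app t c (NormalDual.app s c x) := rfl

theorem NormalDual.app_id (F : NormalDual C) (c : C) (x : (F.obj.obj c).carrier) :
    NormalDual.app (𝟙 F) c x = x := rfl

theorem NormalDual.app_naturality {F G : NormalDual C} (t : F ⟶ G) {c d : C} (g : c ⟶ d)
    (x : (F.obj.obj c).carrier) :
    NormalDual.app t d ((F.obj.map g : (F.obj.obj c).carrier → (F.obj.obj d).carrier) x) =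
      (G.obj.map g : (G.obj.obj c).carrier → (G.obj.obj d).carrier) (NormalDual.app t c x) :=
  congrFun (t.hom.naturality g) x

theorem NormalDual.app_eqToHom {F G : NormalDual C} (h : F = G) (c : C)
    (x : (F.obj.obj c).carrier) :
    (NormalDual.app (eqToHom h) c x : NormalCone C) = x := by
  subst h
  rfl

instance : CategoryWithSubobjects (NormalDual C) where
  Incl t := NormalDual.IsIncl t
  id_mem F c x := rfl
  comp_mem f g hf hg c x := by rw [NormalDual.app_comp, hg, hf]
  unique f g hf hg := NormalDual.hom_ext' fun c x => by rw [hf, hg]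
  antisymm {F G} f g hf hg := by
    have h1 : ∀ c x, x ∈ (F.obj.obj c).carrier → x ∈ (G.obj.obj c).carrier := fun c x hx => by
      have := (NormalDual.app f c ⟨x, hx⟩).2
      rwa [hf] at this
    have h2 : ∀ c x, x ∈ (G.obj.obj c).carrier → x ∈ (F.obj.obj c).carrier := fun c x hx => by
      have := (NormalDual.app g c ⟨x, hx⟩).2
      rwa [hg] at this
    refine ObjectProperty.FullSubcategory.ext
      (SubsetCat.functor_ext (fun c => Set.ext fun x => ⟨h1 c x, h2 c x⟩) ?_)
    intro c d k x hx hx'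
    have e := congrArg Subtype.val (NormalDual.app_naturality f k ⟨x, hx⟩)
    rw [hf] at e
    rw [e]
    have e2 : NormalDual.app f c ⟨x, hx⟩ = ⟨x, hx'⟩ := Subtype.ext (hf c _)
    rw [e2]
  mono {F G} f hf := by
    refine ⟨fun s t h => NormalDual.hom_ext' fun c x => ?_⟩
    have := congrArg (fun k => (NormalDual.app k c x : NormalCone C)) h
    rwa [NormalDual.app_comp, NormalDual.app_comp, hf, hf] at this
  left_mem h g hg hhg c x := by
    have := hhg c x
    rwa [NormalDual.app_comp, hg] at this

/-- Equality of `H`-functors of cones that differ by an isomorphism of the apices. -/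
theorem Hobj_eq (γ δ : NormalCone C) (h : γ.apex ⟶ δ.apex) (k : δ.apex ⟶ γ.apex)
    (hh : ∀ a, γ.comp a ≫ h = δ.comp a) (hk : ∀ a, δ.comp a ≫ k = γ.comp a) :
    Hobj γ = Hobj δ := by
  have e1 : ∀ {c : C} (f : γ.apex ⟶ c), γ.starEpi f = δ.starEpi (k ≫ f) := fun f =>
    (starEpi_eq_iff _ _ _ _).2 fun a => by rw [← Category.assoc, hk]
  have e2 : ∀ {c : C} (f : δ.apex ⟶ c), δ.starEpi f = γ.starEpi (h ≫ f) := fun f =>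
    (starEpi_eq_iff _ _ _ _).2 fun a => by rw [← Category.assoc, hh]
  refine ObjectProperty.FullSubcategory.ext
    (SubsetCat.functor_ext (fun c => Set.ext fun x => ⟨?_, ?_⟩) ?_)
  · rintro ⟨f, rfl⟩
    exact ⟨k ≫ f, (e1 f).symm⟩
  · rintro ⟨f, rfl⟩
    exact ⟨h ≫ f, (e2 f).symm⟩
  · rintro c d g _ ⟨f, rfl⟩ ⟨f', hf'⟩
    refine (Hfunctor_map_starEpi γ f g).trans ?_
    have e3 : (⟨γ.starEpi f, f', hf'⟩ : Hset δ c) = ⟨δ.starEpi f', f', rfl⟩ :=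
      Subtype.ext hf'.symm
    refine Eq.trans ?_ (congrArg (fun z => (((Hfunctor δ).map g : Hset δ c → Hset δ d) z :
      NormalCone C)) e3.symm)
    refine Eq.trans ?_ (Hfunctor_map_starEpi δ f' g).symm
    rw [starEpi_eq_iff] at hf' ⊢
    intro a
    rw [← Category.assoc, ← Category.assoc, hf']

/-- The morphism `η_γ C(r, -) η_δ⁻¹ : H(γ; -) ⟶ H(δ; -)` of the normal dual determined by
`r : c_δ ⟶ c_γ`. -/
noncomputable def Hmap (γ δ : NormalCone C) (r : δ.apex ⟶ γ.apex) : Hobj γ ⟶ Hobj δ :=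
  ObjectProperty.homMk (SubsetCat.liftTrans
    ((eta γ).hom ≫ coyoneda.map r.op ≫ (eta δ).inv))

theorem Hmap_app (γ δ : NormalCone C) (r : δ.apex ⟶ γ.apex) {c : C} (f : γ.apex ⟶ c)
    (h : γ.starEpi f ∈ Hset γ c) :
    (NormalDual.app (Hmap γ δ r) c ⟨γ.starEpi f, h⟩ : NormalCone C) = δ.starEpi (r ≫ f) := by
  change δ.starEpi (r ≫ HsetEquiv γ c ((HsetEquiv γ c).symm f)) = _
  rw [Equiv.apply_symm_apply]

end Dual

/-! ### Local isomorphisms -/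

section Local

/-- The ideal `⟨c⟩`: the full subcategory of the objects `d ⊆ c`. -/
abbrev PrincipalIdeal {C : Type u} [SmallCategory C] [CategoryWithSubobjects C] (c : C) : Type u :=
  ObjectProperty.FullSubcategory (fun d : C => IsSub d c)

variable {C D : Type u} [SmallCategory C] [CategoryWithSubobjects C]
  [SmallCategory D] [CategoryWithSubobjects D]

/-- A functor that maps inclusions to inclusions. -/
def InclusionPreserving (F : C ⥤ D) : Prop :=
  ∀ {a b : C} (j : a ⟶ b), Incl j → Incl (F.map j)

/-- The restriction of an inclusion preserving functor to `⟨c⟩`, with values in `⟨F(c)⟩`. -/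
def restrictIdeal (F : C ⥤ D) (hF : InclusionPreserving F) (c : C) :
    PrincipalIdeal c ⥤ PrincipalIdeal (F.obj c) :=
  ObjectProperty.lift _ (ObjectProperty.ι _ ⋙ F)
    (fun d => let ⟨j, hj⟩ := d.property; ⟨F.map j, hF j hj⟩)

/-- A functor is an isomorphism of categories if it is bijective on objects and fully faithful. -/
structure IsCategoryIso {A B : Type u} [SmallCategory A] [SmallCategory B] (F : A ⥤ B) : Prop where
  obj_bijective : Function.Bijective F.obj
  full : F.Full
  faithful : F.Faithful

/-- A local isomorphism of normal categories. -/
structure IsLocalIsomorphism (F : C ⥤ D) : Prop where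
  normal_source : IsNormalCategory C
  normal_target : IsNormalCategory D
  inclusionPreserving : InclusionPreserving F
  full : F.Full
  faithful : F.Faithful
  iso_on_ideals : ∀ c : C, IsCategoryIso (restrictIdeal F inclusionPreserving c)

end Local

/-! ### Regular semigroups, idempotents and the groupoid `G(S)` -/

/-- `b` is an inverse of `a`. -/
def IsInverse {S : Type u} [Semigroup S] (a b : S) : Prop := a * b * a = a ∧ b * a * b = b

/-- A regular semigroup: every element has an inverse. -/
class IsRegularSemigroup (S : Type u) [Semigroup S] : Prop where
  exists_inverse : ∀ a : S, ∃ b : S, IsInverse a b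

/-- The set `E` of idempotents of `S`. -/
@[ext]
structure Idem (S : Type u) [Semigroup S] where
  val : S
  idem : val * val = val

section Biorder

variable {S : Type u} [Semigroup S]

/-- The quasi-order `ω^l`. -/
def OmegaL (e f : Idem S) : Prop := e.val * f.val = e.val

/-- The quasi-order `ω^r`. -/
def OmegaR (e f : Idem S) : Prop := f.val * e.val = e.val

/-- Green's relation `L` on idempotents. -/
def GreenL (e f : Idem S) : Prop := OmegaL e f ∧ OmegaL f e

/-- Green's relation `R` on idempotents. -/
def GreenR (e f : Idem S) : Prop := OmegaR e f ∧ OmegaR f e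

theorem OmegaL.trans {e f g : Idem S} (h : OmegaL e f) (k : OmegaL f g) : OmegaL e g := by
  unfold OmegaL at *
  rw [← h, mul_assoc, k]

theorem OmegaR.trans {e f g : Idem S} (h : OmegaR e f) (k : OmegaR f g) : OmegaR e g := by
  unfold OmegaR at *
  rw [← h, ← mul_assoc, k]

theorem GreenL.refl (e : Idem S) : GreenL e e := ⟨e.idem, e.idem⟩

theorem GreenR.refl (e : Idem S) : GreenR e e := ⟨e.idem, e.idem⟩

theorem GreenL.symm {e f : Idem S} (h : GreenL e f) : GreenL f e := ⟨h.2, h.1⟩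

theorem GreenR.symm {e f : Idem S} (h : GreenR e f) : GreenR f e := ⟨h.2, h.1⟩

theorem GreenL.trans {e f g : Idem S} (h : GreenL e f) (k : GreenL f g) : GreenL e g :=
  ⟨h.1.trans k.1, k.2.trans h.2⟩

theorem GreenR.trans {e f g : Idem S} (h : GreenR e f) (k : GreenR f g) : GreenR e g :=
  ⟨h.1.trans k.1, k.2.trans h.2⟩

/-- A morphism `(x, x')` from `e = x x'` to `f = x' x` of the inductive groupoid `G(S)`. -/
@[ext]
structure GHom (e f : Idem S) where
  x : S
  x' : S
  inverse : IsInverse x x'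
  dom_eq : x * x' = e.val
  cod_eq : x' * x = f.val

/-- The inductive groupoid `G(S)` as a groupoid, with `(x, x') (y, y') = (x y, y' x')` and
`(x, x')⁻¹ = (x', x)`. -/
instance : Groupoid (Idem S) where
  Hom e f := GHom e f
  id e := ⟨e.val, e.val, ⟨by rw [e.idem, e.idem], by rw [e.idem, e.idem]⟩, e.idem, e.idem⟩
  comp {e f g} p q := by
    have h1 : p.x * q.x * (q.x' * p.x') = e.val := by
      rw [mul_assoc, ← mul_assoc q.x, q.dom_eq, ← p.cod_eq, ← mul_assoc, ← mul_assoc,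
        p.inverse.1, p.dom_eq]
    have h2 : q.x' * p.x' * (p.x * q.x) = g.val := by
      rw [mul_assoc, ← mul_assoc p.x', p.cod_eq, ← q.dom_eq, ← mul_assoc, ← mul_assoc,
        q.inverse.2, q.cod_eq]
    exact ⟨p.x * q.x, q.x' * p.x',
      ⟨by rw [h1, ← p.dom_eq, ← mul_assoc, p.inverse.1],
        by rw [h2, ← q.cod_eq, ← mul_assoc, q.inverse.2]⟩, h1, h2⟩
  id_comp {e f} p := GHom.ext (by
      change e.val * p.x = p.x
      rw [← p.dom_eq, p.inverse.1]) (by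
      change p.x' * e.val = p.x'
      rw [← p.dom_eq, ← mul_assoc, p.inverse.2])
  comp_id {e f} p := GHom.ext (by
      change p.x * f.val = p.x
      rw [← p.cod_eq, ← mul_assoc, p.inverse.1]) (by
      change f.val * p.x' = p.x'
      rw [← p.cod_eq, p.inverse.2])
  assoc p q r := GHom.ext (mul_assoc _ _ _) (mul_assoc _ _ _).symm
  inv p := ⟨p.x', p.x, ⟨p.inverse.2, p.inverse.1⟩, p.cod_eq, p.dom_eq⟩
  inv_comp {e f} p := GHom.ext p.cod_eq p.cod_eq
  comp_inv {e f} p := GHom.ext p.dom_eq p.dom_eq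

end Biorder

/-- A triple `(e, u, f)`, to be read as a morphism `r(e, u, f)` or `l(e, u, f)`. -/
structure Triple (S : Type u) [Semigroup S] where
  dom : Idem S
  elt : S
  cod : Idem S

/-! ### The category `L_G` -/

section LG

variable {S : Type u} [Semigroup S]

/-- `r(e, e, f)` with `e ω^l f`: the morphisms of `P_L`. -/
def IsPL (t : Triple S) : Prop := t.elt = t.dom.val ∧ OmegaL t.dom t.cod

/-- `r(e, u, f)` with `u ∈ E(L_f) ∩ ω(e)`: the morphisms of `Q_L`. -/
def IsQL (t : Triple S) : Prop :=
  ∃ g : Idem S, g.val = t.elt ∧ GreenL g t.cod ∧ OmegaL g t.dom ∧ OmegaR g t.dom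

/-- `r(e, x, f)` for a morphism `(x, x')` from `e` to `f` of `G(S)`: the morphisms of `G_L`. -/
def IsGL (t : Triple S) : Prop := ∃ p : t.dom ⟶ t.cod, p.x = t.elt

/-- The morphisms generated by the quiver `P_L ∪ Q_L ∪ G_L` under the composition
`r(e, u, f) r(g, v, h) = r(e, u v, h)`, defined when `f` and `g` are `L`-related. (The identities
`r(e, e, e)` belong to `P_L`.) -/
inductive LFree : Triple S → Prop
  | gen (t : Triple S) : IsPL t ∨ IsQL t ∨ IsGL t → LFree t
  | comp (s t : Triple S) : LFree s → LFree t → GreenL s.cod t.dom →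
      LFree ⟨s.dom, s.elt * t.elt, t.cod⟩

/-- `r(e, u, f) ∼ r(g, v, h)` if and only if `e L g`, `f L h` and `u = e v`. -/
def LSim (s t : Triple S) : Prop :=
  GreenL s.dom t.dom ∧ GreenL s.cod t.cod ∧ s.elt = s.dom.val * t.elt

theorem LFree.elt_mem {t : Triple S} (h : LFree t) :
    t.dom.val * t.elt = t.elt ∧ t.elt * t.cod.val = t.elt := by
  induction h with
  | gen t h =>
    rcases h with ⟨h1, h2⟩ | ⟨g, hg, h1, h2, h3⟩ | ⟨p, hp⟩
    · rw [h1]; exact ⟨t.dom.idem, h2⟩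
    · rw [← hg]; exact ⟨h3, h1.1⟩
    · rw [← hp, ← p.dom_eq, ← p.cod_eq, ← mul_assoc]; exact ⟨p.inverse.1, p.inverse.1⟩
  | comp s t hs ht hst ihs iht =>
    exact ⟨by rw [← mul_assoc, ihs.1], by rw [mul_assoc, iht.2]⟩

variable (S) in
/-- The relation `L` as an equivalence relation on `E`. -/
def lSetoid : Setoid (Idem S) := ⟨GreenL, GreenL.refl, GreenL.symm, GreenL.trans⟩

variable (S) in
/-- The object set `E/L` of the category `L_G`. -/
def LG : Type u := Quotient (lSetoid S)

/-- The image of `e` in `E/L`. -/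
def LG.of (e : Idem S) : LG S := Quotient.mk (lSetoid S) e

theorem LG.of_eq_iff {e f : Idem S} : LG.of e = LG.of f ↔ GreenL e f :=
  ⟨fun h => Quotient.exact (s := lSetoid S) h, fun h => Quotient.sound (s := lSetoid S) h⟩

theorem LG.exists_rep (a : LG S) : ∃ e : Idem S, LG.of e = a :=
  Quotient.exists_rep (s := lSetoid S) a

/-- Generated morphisms from `a` to `b`. -/
def LPre (a b : LG S) : Type u :=
  {t : Triple S // LFree t ∧ LG.of t.dom = a ∧ LG.of t.cod = b}

/-- The relation `∼` as an equivalence relation. -/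
def lSimSetoid (a b : LG S) : Setoid (LPre a b) where
  r s t := LSim s.1 t.1
  iseqv :=
    { refl := fun s => ⟨GreenL.refl _, GreenL.refl _, s.2.1.elt_mem.1.symm⟩
      symm := by
        rintro s t ⟨h1, h2, h3⟩
        refine ⟨h1.symm, h2.symm, ?_⟩
        rw [h3, ← mul_assoc, h1.2, t.2.1.elt_mem.1]
      trans := by
        rintro s t w ⟨h1, h2, h3⟩ ⟨k1, k2, k3⟩
        refine ⟨h1.trans k1, h2.trans k2, ?_⟩
        rw [h3, k3, ← mul_assoc, h1.1] }

theorem lSim_comp {a b c : LG S} (s s' : LPre a b) (t t' : LPre b c) (hs : LSim s.1 s'.1)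
    (ht : LSim t.1 t'.1) :
    LSim ⟨s.1.dom, s.1.elt * t.1.elt, t.1.cod⟩ ⟨s'.1.dom, s'.1.elt * t'.1.elt, t'.1.cod⟩ := by
  refine ⟨hs.1, ht.2.1, ?_⟩
  have h : GreenL s.1.cod t.1.dom := LG.of_eq_iff.1 (s.2.2.2.trans t.2.2.1.symm)
  change s.1.elt * t.1.elt = s.1.dom.val * (s'.1.elt * t'.1.elt)
  have h2 : s.1.elt * t.1.dom.val = s.1.elt := by
    rw [← s.2.1.elt_mem.2, mul_assoc, h.1]
  rw [ht.2.2, ← mul_assoc, h2, hs.2.2, mul_assoc]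

/-- The category `L_G`. Composition is diagrammatic: `r(e, u, f) ≫ r(f, v, g) = r(e, u v, g)`. -/
noncomputable instance : SmallCategory (LG S) where
  Hom a b := Quotient (lSimSetoid a b)
  id a := Quotient.mk (lSimSetoid a a)
    ⟨⟨a.out, a.out.val, a.out⟩, LFree.gen _ (Or.inl ⟨rfl, a.out.idem⟩),
      Quotient.out_eq a, Quotient.out_eq a⟩
  comp {a b c} := Quotient.map₂ (sa := lSimSetoid a b) (sb := lSimSetoid b c)
    (sc := lSimSetoid a c)
    (fun s t => ⟨⟨s.1.dom, s.1.elt * t.1.elt, t.1.cod⟩,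
      LFree.comp _ _ s.2.1 t.2.1 (LG.of_eq_iff.1 (s.2.2.2.trans t.2.2.1.symm)),
      s.2.2.1, t.2.2.2⟩)
    (fun s s' hs t t' ht => lSim_comp s s' t t' hs ht)
  id_comp {a b} f := by
    induction f using Quotient.inductionOn with | _ s => ?_
    refine Quotient.sound (s := lSimSetoid a b) ⟨?_, GreenL.refl _, rfl⟩
    exact LG.of_eq_iff.1 ((Quotient.out_eq a).trans s.2.2.1.symm)
  comp_id {a b} f := by
    induction f using Quotient.inductionOn with | _ s => ?_
    have h : GreenL s.1.cod b.out := LG.of_eq_iff.1 (s.2.2.2.trans (Quotient.out_eq b).symm)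
    refine Quotient.sound (s := lSimSetoid a b) ⟨GreenL.refl _, h.symm, ?_⟩
    change s.1.elt * b.out.val = s.1.dom.val * s.1.elt
    rw [s.2.1.elt_mem.1, ← s.2.1.elt_mem.2, mul_assoc, h.1]
  assoc {a b c d} f g h := by
    induction f using Quotient.inductionOn with | _ s => ?_
    induction g using Quotient.inductionOn with | _ t => ?_
    induction h using Quotient.inductionOn with | _ w => ?_
    refine congrArg (Quotient.mk (lSimSetoid a d)) (Subtype.ext ?_)
    exact congrArg (fun z => Triple.mk s.1.dom z w.1.cod) (mul_assoc _ _ _)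

/-- Inclusions of `L_G`: the classes of the morphisms of `P_L`. -/
def LG.IsIncl {a b : LG S} (φ : a ⟶ b) : Prop :=
  ∃ t : LPre a b, IsPL t.1 ∧ Quotient.mk (lSimSetoid a b) t = φ

variable [IsRegularSemigroup S]

/-- Every `u ∈ e S f` gives a generated morphism `r(e, u, f) = r(e, g, g) r(g, u, h) r(h, h, f)`. -/
theorem lFree_of_mem (e : Idem S) (u : S) (f : Idem S) (h1 : e.val * u = u) (h2 : u * f.val = u) :
    LFree ⟨e, u, f⟩ := by
  obtain ⟨v, hv1, hv2⟩ := IsRegularSemigroup.exists_inverse u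
  have i1 : (u * v * e.val) * (u * v * e.val) = u * v * e.val := by
    rw [show (u * v * e.val) * (u * v * e.val) = u * v * (e.val * u) * v * e.val by
      simp only [mul_assoc], h1, hv1]
  have i2 : v * u * (v * u) = v * u := by rw [← mul_assoc, hv2]
  let g : Idem S := ⟨u * v * e.val, i1⟩
  let h : Idem S := ⟨v * u, i2⟩
  have gu : g.val * u = u := by
    change u * v * e.val * u = u
    rw [mul_assoc, h1, hv1]
  have uh : u * h.val = u := by
    change u * (v * u) = u
    rw [← mul_assoc, hv1]
  have a1 : LFree ⟨e, g.val, g⟩ := by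
    refine LFree.gen _ (Or.inr (Or.inl ⟨g, rfl, GreenL.refl _, ?_, ?_⟩))
    · change u * v * e.val * e.val = _
      rw [mul_assoc, e.idem]
    · change e.val * (u * v * e.val) = u * v * e.val
      rw [← mul_assoc, ← mul_assoc, h1]
  have a2 : LFree ⟨g, u, h⟩ := by
    refine LFree.gen _ (Or.inr (Or.inr ⟨⟨u, v * e.val, ⟨?_, ?_⟩, ?_, ?_⟩, rfl⟩))
    · rw [mul_assoc, mul_assoc, h1, ← mul_assoc, hv1]
    · rw [mul_assoc v, h1, ← mul_assoc, hv2]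
    · exact (mul_assoc _ _ _).symm
    · rw [mul_assoc, h1]
  have a3 : LFree ⟨h, h.val, f⟩ := by
    refine LFree.gen _ (Or.inl ⟨rfl, ?_⟩)
    change v * u * f.val = v * u
    rw [mul_assoc, h2]
  have := LFree.comp _ _ (LFree.comp _ _ a1 a2 (GreenL.refl _)) a3 (GreenL.refl _)
  simpa only [gu, uh] using this

/-- The morphism `r(e, u, f)` of `L_G`, for `u ∈ e S f`. -/
def LG.r {a b : LG S} (e : Idem S) (u : S) (f : Idem S) (h1 : e.val * u = u) (h2 : u * f.val = u)
    (ha : LG.of e = a) (hb : LG.of f = b) : a ⟶ b :=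
  Quotient.mk (lSimSetoid a b) ⟨⟨e, u, f⟩, lFree_of_mem e u f h1 h2, ha, hb⟩

theorem LG.r_eq_iff {a b : LG S} {e : Idem S} {u : S} {f : Idem S} {h1 : e.val * u = u}
    {h2 : u * f.val = u} {ha : LG.of e = a} {hb : LG.of f = b}
    {g : Idem S} {v : S} {h : Idem S} {h3 : g.val * v = v}
    {h4 : v * h.val = v} {ha' : LG.of g = a} {hb' : LG.of h = b} :
    LG.r e u f h1 h2 ha hb = LG.r g v h h3 h4 ha' hb' ↔ u = e.val * v := by
  constructor
  · intro h
    exact (Quotient.exact (s := lSimSetoid a b) h).2.2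
  · intro h
    exact Quotient.sound (s := lSimSetoid a b) ⟨LG.of_eq_iff.1 (ha.trans ha'.symm),
      LG.of_eq_iff.1 (hb.trans hb'.symm), h⟩

theorem LG.r_comp {a b c : LG S} {e : Idem S} {u : S} {f : Idem S} {h1 : e.val * u = u}
    {h2 : u * f.val = u} {ha : LG.of e = a} {hb : LG.of f = b}
    {g : Idem S} {v : S} {h : Idem S} {h3 : g.val * v = v}
    {h4 : v * h.val = v} {hb' : LG.of g = b} {hc : LG.of h = c} :
    LG.r e u f h1 h2 ha hb ≫ LG.r g v h h3 h4 hb' hc =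
      LG.r e (u * v) h (by rw [← mul_assoc, h1]) (by rw [mul_assoc, h4]) ha hc := rfl

theorem LG.id_eq {a : LG S} (e : Idem S) (ha : LG.of e = a) :
    𝟙 a = LG.r e e.val e e.idem e.idem ha ha :=
  Quotient.sound (s := lSimSetoid a a) ⟨LG.of_eq_iff.1 ((Quotient.out_eq a).trans ha.symm),
    LG.of_eq_iff.1 ((Quotient.out_eq a).trans ha.symm),
    (LG.of_eq_iff.1 ((Quotient.out_eq a).trans ha.symm)).1.symm⟩

theorem LG.exists_r {a b : LG S} (φ : a ⟶ b) (e f : Idem S) (ha : LG.of e = a)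
    (hb : LG.of f = b) : ∃ (u : S) (h1 : e.val * u = u) (h2 : u * f.val = u),
      φ = LG.r e u f h1 h2 ha hb := by
  obtain ⟨t, rfl⟩ := Quotient.exists_rep (s := lSimSetoid a b) φ
  have k1 := LG.of_eq_iff.1 (ha.trans t.2.2.1.symm)
  have k2 := LG.of_eq_iff.1 (hb.trans t.2.2.2.symm)
  refine ⟨e.val * t.1.elt, by rw [← mul_assoc, e.idem], ?_, ?_⟩
  · rw [mul_assoc, ← t.2.1.elt_mem.2, mul_assoc t.1.elt, k2.2]
  · refine Quotient.sound (s := lSimSetoid a b) ⟨k1.symm, k2.symm, ?_⟩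
    change t.1.elt = t.1.dom.val * (e.val * t.1.elt)
    rw [← mul_assoc, k1.2, t.2.1.elt_mem.1]

theorem LG.isIncl_r_iff {a b : LG S} {e : Idem S} {u : S} {f : Idem S} {h1 : e.val * u = u}
    {h2 : u * f.val = u} {ha : LG.of e = a} {hb : LG.of f = b} :
    LG.IsIncl (LG.r e u f h1 h2 ha hb) ↔ u = e.val := by
  constructor
  · rintro ⟨t, ⟨ht, -⟩, h⟩
    have h' := Quotient.exact (s := lSimSetoid a b) h.symm
    have := h'.2.2
    change u = e.val * t.1.elt at this
    rw [this, ht]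
    exact h'.1.1
  · rintro rfl
    exact ⟨⟨⟨e, e.val, f⟩, lFree_of_mem _ _ _ h1 h2, ha, hb⟩, ⟨rfl, h2⟩, rfl⟩

instance : CategoryWithSubobjects (LG S) where
  Incl φ := LG.IsIncl φ
  id_mem a := by
    obtain ⟨e, rfl⟩ := LG.exists_rep a
    rw [LG.id_eq e rfl, LG.isIncl_r_iff]
  comp_mem {a b c} φ ψ hφ hψ := by
    obtain ⟨e, rfl⟩ := LG.exists_rep a
    obtain ⟨f, rfl⟩ := LG.exists_rep b
    obtain ⟨g, rfl⟩ := LG.exists_rep c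
    obtain ⟨u, h1, h2, rfl⟩ := LG.exists_r φ e f rfl rfl
    obtain ⟨v, h3, h4, rfl⟩ := LG.exists_r ψ f g rfl rfl
    rw [LG.isIncl_r_iff] at hφ hψ
    rw [LG.r_comp, LG.isIncl_r_iff, hψ, h2, hφ]
  unique {a b} φ ψ hφ hψ := by
    obtain ⟨e, rfl⟩ := LG.exists_rep a
    obtain ⟨f, rfl⟩ := LG.exists_rep b
    obtain ⟨u, h1, h2, rfl⟩ := LG.exists_r φ e f rfl rfl
    obtain ⟨v, h3, h4, rfl⟩ := LG.exists_r ψ e f rfl rfl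
    rw [LG.isIncl_r_iff] at hφ hψ
    rw [LG.r_eq_iff, h3, hφ, hψ]
  antisymm {a b} φ ψ hφ hψ := by
    obtain ⟨e, rfl⟩ := LG.exists_rep a
    obtain ⟨f, rfl⟩ := LG.exists_rep b
    obtain ⟨u, h1, h2, rfl⟩ := LG.exists_r φ e f rfl rfl
    obtain ⟨v, h3, h4, rfl⟩ := LG.exists_r ψ f e rfl rfl
    rw [LG.isIncl_r_iff] at hφ hψ
    rw [hφ] at h2
    rw [hψ] at h4
    exact LG.of_eq_iff.2 ⟨h2, h4⟩
  mono {a b} φ hφ := by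
    obtain ⟨e, rfl⟩ := LG.exists_rep a
    obtain ⟨f, rfl⟩ := LG.exists_rep b
    obtain ⟨u, h1, h2, rfl⟩ := LG.exists_r φ e f rfl rfl
    rw [LG.isIncl_r_iff] at hφ
    refine ⟨fun {c} ψ χ h => ?_⟩
    obtain ⟨g, rfl⟩ := LG.exists_rep c
    obtain ⟨v, h3, h4, rfl⟩ := LG.exists_r ψ g e rfl rfl
    obtain ⟨w, h5, h6, rfl⟩ := LG.exists_r χ g e rfl rfl
    rw [LG.r_comp, LG.r_comp, LG.r_eq_iff, hφ, h4, h6] at h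
    exact LG.r_eq_iff.2 h
  left_mem {a b c} φ ψ hψ h := by
    obtain ⟨e, rfl⟩ := LG.exists_rep a
    obtain ⟨f, rfl⟩ := LG.exists_rep b
    obtain ⟨g, rfl⟩ := LG.exists_rep c
    obtain ⟨u, h1, h2, rfl⟩ := LG.exists_r φ e f rfl rfl
    obtain ⟨v, h3, h4, rfl⟩ := LG.exists_r ψ f g rfl rfl
    rw [LG.r_comp, LG.isIncl_r_iff] at h
    rw [LG.isIncl_r_iff] at hψ ⊢
    rwa [hψ, h2] at h

/-- The components `r^e(ḡ) = r(g, g e, e)` of the principal cone of an idempotent `e`. -/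
noncomputable def principalComp (e : Idem S) (a : LG S) : a ⟶ LG.of e :=
  LG.r a.out (a.out.val * e.val) e (by rw [← mul_assoc, a.out.idem])
    (by rw [mul_assoc, e.idem]) (Quotient.out_eq a) rfl

theorem principalComp_eq (e g : Idem S) {a : LG S} (ha : LG.of g = a) :
    principalComp e a = LG.r g (g.val * e.val) e (by rw [← mul_assoc, g.idem])
      (by rw [mul_assoc, e.idem]) ha rfl := by
  refine LG.r_eq_iff.2 ?_
  rw [← mul_assoc, (LG.of_eq_iff.1 ((Quotient.out_eq a).trans ha.symm)).1]

theorem principalComp_self (e : Idem S) : principalComp e (LG.of e) = 𝟙 (LG.of e) := by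
  rw [principalComp_eq e e rfl, LG.id_eq e rfl, LG.r_eq_iff]

theorem isNormalCone_principalComp (e : Idem S) : IsNormalCone (principalComp e) := by
  refine ⟨fun {a b} j hj => ?_, LG.of e, ?_⟩
  · obtain ⟨f, rfl⟩ := LG.exists_rep a
    obtain ⟨g, rfl⟩ := LG.exists_rep b
    obtain ⟨u, h1, h2, rfl⟩ := LG.exists_r j f g rfl rfl
    have hj' : u = f.val := LG.isIncl_r_iff.1 hj
    rw [principalComp_eq e f rfl, principalComp_eq e g rfl, LG.r_comp, LG.r_eq_iff,
      ← mul_assoc, h2, hj', ← mul_assoc, f.idem]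
  · rw [principalComp_self]; infer_instance

/-- The principal cone `r^e`, with apex the image of `e` in `E/L`. -/
noncomputable abbrev principalCone (e : Idem S) : NormalCone (LG S) where
  apex := LG.of e
  comp := principalComp e
  isNormal := isNormalCone_principalComp e

instance : IsNormalCategory (LG S) where
  exists_factorization {a b} φ := by
    obtain ⟨e, rfl⟩ := LG.exists_rep a
    obtain ⟨f, rfl⟩ := LG.exists_rep b
    obtain ⟨u, h1, h2, rfl⟩ := LG.exists_r φ e f rfl rfl
    obtain ⟨v, hv1, hv2⟩ := IsRegularSemigroup.exists_inverse u
    have i1 : (u * v * e.val) * (u * v * e.val) = u * v * e.val := by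
      rw [show (u * v * e.val) * (u * v * e.val) = u * v * (e.val * u) * v * e.val by
        simp only [mul_assoc], h1, hv1]
    have i2 : v * u * (v * u) = v * u := by rw [← mul_assoc, hv2]
    obtain ⟨g, hg⟩ : ∃ g : Idem S, g.val = u * v * e.val := ⟨⟨_, i1⟩, rfl⟩
    obtain ⟨h, hh⟩ : ∃ h : Idem S, h.val = v * u := ⟨⟨_, i2⟩, rfl⟩
    have gu : g.val * u = u := by rw [hg, mul_assoc, h1, hv1]
    have uh : u * h.val = u := by rw [hh, ← mul_assoc, hv1]
    have eg : e.val * g.val = g.val := by rw [hg, ← mul_assoc, ← mul_assoc, h1]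
    have ge : g.val * e.val = g.val := by rw [hg, mul_assoc, e.idem]
    have hf : h.val * f.val = h.val := by rw [hh, mul_assoc, h2]
    have w1 : h.val * (v * e.val) = v * e.val := by rw [hh, ← mul_assoc, hv2]
    have w2 : v * e.val * g.val = v * e.val := by
      rw [mul_assoc, eg, hg, ← mul_assoc, ← mul_assoc, hv2]
    refine ⟨⟨LG.of g, LG.of h, LG.r e g.val g eg g.idem rfl rfl, LG.r g u h gu uh rfl rfl,
      LG.r h h.val f h.idem hf rfl rfl, ⟨LG.r g g.val e g.idem ge rfl rfl, ?_, ?_⟩, ?_, ?_, ?_⟩⟩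
    · exact LG.isIncl_r_iff.2 rfl
    · rw [LG.r_comp, LG.id_eq g rfl, LG.r_eq_iff]
    · refine ⟨LG.r h (v * e.val) g w1 w2 rfl rfl, ?_, ?_⟩
      · rw [LG.r_comp, LG.id_eq g rfl, LG.r_eq_iff, g.idem, hg, mul_assoc]
      · rw [LG.r_comp, LG.id_eq h rfl, LG.r_eq_iff, h.idem, hh, mul_assoc, h1]
    · exact LG.isIncl_r_iff.2 rfl
    · rw [LG.r_comp, LG.r_comp, LG.r_eq_iff, h1, uh, gu]
  incl_splits {a b} j hj := by
    obtain ⟨e, rfl⟩ := LG.exists_rep a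
    obtain ⟨f, rfl⟩ := LG.exists_rep b
    obtain ⟨u, h1, h2, rfl⟩ := LG.exists_r j e f rfl rfl
    obtain rfl : u = e.val := LG.isIncl_r_iff.1 hj
    refine ⟨LG.r f (f.val * e.val) e (by rw [← mul_assoc, f.idem]) (by rw [mul_assoc, e.idem])
      rfl rfl, ?_⟩
    rw [LG.r_comp, LG.id_eq e rfl, LG.r_eq_iff, ← mul_assoc, h2]
  exists_cone a := by
    obtain ⟨e, rfl⟩ := LG.exists_rep a
    exact ⟨principalComp e, isNormalCone_principalComp e, principalComp_self e⟩

end LG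

/-! ### The category `R_G` -/

section RG

variable {S : Type u} [Semigroup S]

/-- `l(e, e, f)` with `e ω^r f`: the morphisms of `P_R`. -/
def IsPR (t : Triple S) : Prop := t.elt = t.dom.val ∧ OmegaR t.dom t.cod

/-- `l(e, u, f)` with `u ∈ E(R_f) ∩ ω(e)`: the morphisms of `Q_R`. -/
def IsQR (t : Triple S) : Prop :=
  ∃ g : Idem S, g.val = t.elt ∧ GreenR g t.cod ∧ OmegaL g t.dom ∧ OmegaR g t.dom

/-- `l(e, x', f)` for a morphism `(x, x')` from `e` to `f` of `G(S)`: the morphisms of `G_R`. -/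
def IsGR (t : Triple S) : Prop := ∃ p : t.dom ⟶ t.cod, p.x' = t.elt

/-- The morphisms generated by the quiver `P_R ∪ Q_R ∪ G_R` under the composition
`l(e, u, f) l(g, v, h) = l(e, v u, h)`, defined when `f` and `g` are `R`-related. (The identities
`l(e, e, e)` belong to `P_R`.) -/
inductive RFree : Triple S → Prop
  | gen (t : Triple S) : IsPR t ∨ IsQR t ∨ IsGR t → RFree t
  | comp (s t : Triple S) : RFree s → RFree t → GreenR s.cod t.dom →
      RFree ⟨s.dom, t.elt * s.elt, t.cod⟩

/-- `l(e, u, f) ∼ l(g, v, h)` if and only if `e R g`, `f R h` and `u = v e`. -/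
def RSim (s t : Triple S) : Prop :=
  GreenR s.dom t.dom ∧ GreenR s.cod t.cod ∧ s.elt = t.elt * s.dom.val

theorem RFree.elt_mem {t : Triple S} (h : RFree t) :
    t.cod.val * t.elt = t.elt ∧ t.elt * t.dom.val = t.elt := by
  induction h with
  | gen t h =>
    rcases h with ⟨h1, h2⟩ | ⟨g, hg, h1, h2, h3⟩ | ⟨p, hp⟩
    · rw [h1]; exact ⟨h2, t.dom.idem⟩
    · rw [← hg]; exact ⟨h1.1, h2⟩
    · rw [← hp, ← p.dom_eq, ← p.cod_eq, ← mul_assoc]; exact ⟨p.inverse.2, p.inverse.2⟩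
  | comp s t hs ht hst ihs iht =>
    exact ⟨by rw [← mul_assoc, iht.1], by rw [mul_assoc, ihs.2]⟩

variable (S) in
/-- The relation `R` as an equivalence relation on `E`. -/
def rSetoid : Setoid (Idem S) := ⟨GreenR, GreenR.refl, GreenR.symm, GreenR.trans⟩

variable (S) in
/-- The object set `E/R` of the category `R_G`. -/
def RG : Type u := Quotient (rSetoid S)

/-- The image of `e` in `E/R`. -/
def RG.of (e : Idem S) : RG S := Quotient.mk (rSetoid S) e

theorem RG.of_eq_iff {e f : Idem S} : RG.of e = RG.of f ↔ GreenR e f :=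
  ⟨fun h => Quotient.exact (s := rSetoid S) h, fun h => Quotient.sound (s := rSetoid S) h⟩

theorem RG.exists_rep (a : RG S) : ∃ e : Idem S, RG.of e = a :=
  Quotient.exists_rep (s := rSetoid S) a

/-- Generated morphisms from `a` to `b`. -/
def RPre (a b : RG S) : Type u :=
  {t : Triple S // RFree t ∧ RG.of t.dom = a ∧ RG.of t.cod = b}

/-- The relation `∼` as an equivalence relation. -/
def rSimSetoid (a b : RG S) : Setoid (RPre a b) where
  r s t := RSim s.1 t.1
  iseqv :=
    { refl := fun s => ⟨GreenR.refl _, GreenR.refl _, s.2.1.elt_mem.2.symm⟩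
      symm := by
        rintro s t ⟨h1, h2, h3⟩
        refine ⟨h1.symm, h2.symm, ?_⟩
        rw [h3, mul_assoc, h1.2, t.2.1.elt_mem.2]
      trans := by
        rintro s t w ⟨h1, h2, h3⟩ ⟨k1, k2, k3⟩
        refine ⟨h1.trans k1, h2.trans k2, ?_⟩
        rw [h3, k3, mul_assoc, h1.1] }

theorem rSim_comp {a b c : RG S} (s s' : RPre a b) (t t' : RPre b c) (hs : RSim s.1 s'.1)
    (ht : RSim t.1 t'.1) :
    RSim ⟨s.1.dom, t.1.elt * s.1.elt, t.1.cod⟩ ⟨s'.1.dom, t'.1.elt * s'.1.elt, t'.1.cod⟩ := by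
  refine ⟨hs.1, ht.2.1, ?_⟩
  have h : GreenR s.1.cod t.1.dom := RG.of_eq_iff.1 (s.2.2.2.trans t.2.2.1.symm)
  change t.1.elt * s.1.elt = t'.1.elt * s'.1.elt * s.1.dom.val
  have h2 : t.1.dom.val * s.1.elt = s.1.elt := by
    rw [← s.2.1.elt_mem.1, ← mul_assoc, h.1]
  rw [ht.2.2, mul_assoc, h2, hs.2.2, mul_assoc]

/-- The category `R_G`. Composition is diagrammatic: `l(e, u, f) ≫ l(f, v, g) = l(e, v u, g)`. -/
noncomputable instance : SmallCategory (RG S) where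
  Hom a b := Quotient (rSimSetoid a b)
  id a := Quotient.mk (rSimSetoid a a)
    ⟨⟨a.out, a.out.val, a.out⟩, RFree.gen _ (Or.inl ⟨rfl, a.out.idem⟩),
      Quotient.out_eq a, Quotient.out_eq a⟩
  comp {a b c} := Quotient.map₂ (sa := rSimSetoid a b) (sb := rSimSetoid b c)
    (sc := rSimSetoid a c)
    (fun s t => ⟨⟨s.1.dom, t.1.elt * s.1.elt, t.1.cod⟩,
      RFree.comp _ _ s.2.1 t.2.1 (RG.of_eq_iff.1 (s.2.2.2.trans t.2.2.1.symm)),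
      s.2.2.1, t.2.2.2⟩)
    (fun s s' hs t t' ht => rSim_comp s s' t t' hs ht)
  id_comp {a b} f := by
    induction f using Quotient.inductionOn with | _ s => ?_
    refine Quotient.sound (s := rSimSetoid a b) ⟨?_, GreenR.refl _, rfl⟩
    exact RG.of_eq_iff.1 ((Quotient.out_eq a).trans s.2.2.1.symm)
  comp_id {a b} f := by
    induction f using Quotient.inductionOn with | _ s => ?_
    have h : GreenR s.1.cod b.out := RG.of_eq_iff.1 (s.2.2.2.trans (Quotient.out_eq b).symm)
    refine Quotient.sound (s := rSimSetoid a b) ⟨GreenR.refl _, h.symm, ?_⟩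
    change b.out.val * s.1.elt = s.1.elt * s.1.dom.val
    rw [s.2.1.elt_mem.2, ← s.2.1.elt_mem.1, ← mul_assoc, h.1]
  assoc {a b c d} f g h := by
    induction f using Quotient.inductionOn with | _ s => ?_
    induction g using Quotient.inductionOn with | _ t => ?_
    induction h using Quotient.inductionOn with | _ w => ?_
    refine congrArg (Quotient.mk (rSimSetoid a d)) (Subtype.ext ?_)
    exact congrArg (fun z => Triple.mk s.1.dom z w.1.cod) (mul_assoc _ _ _).symm

/-- Inclusions of `R_G`: the classes of the morphisms of `P_R`. -/
def RG.IsIncl {a b : RG S} (φ : a ⟶ b) : Prop :=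
  ∃ t : RPre a b, IsPR t.1 ∧ Quotient.mk (rSimSetoid a b) t = φ

variable [IsRegularSemigroup S]

/-- Every `u ∈ f S e` gives a generated morphism `l(e, u, f) = l(e, g, g) l(g, u, h) l(h, h, f)`. -/
theorem rFree_of_mem (e : Idem S) (u : S) (f : Idem S) (h1 : f.val * u = u) (h2 : u * e.val = u) :
    RFree ⟨e, u, f⟩ := by
  obtain ⟨v, hv1, hv2⟩ := IsRegularSemigroup.exists_inverse u
  have i1 : (e.val * (v * u)) * (e.val * (v * u)) = e.val * (v * u) := by
    rw [show (e.val * (v * u)) * (e.val * (v * u)) = e.val * (v * (u * e.val * v * u)) by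
      simp only [mul_assoc], h2, hv1]
  have i2 : u * v * (u * v) = u * v := by rw [← mul_assoc, hv1]
  let g : Idem S := ⟨e.val * (v * u), i1⟩
  let h : Idem S := ⟨u * v, i2⟩
  have ug : u * g.val = u := by
    change u * (e.val * (v * u)) = u
    rw [← mul_assoc, h2, ← mul_assoc, hv1]
  have hu : h.val * u = u := hv1
  have a1 : RFree ⟨e, g.val, g⟩ := by
    refine RFree.gen _ (Or.inr (Or.inl ⟨g, rfl, GreenR.refl _, ?_, ?_⟩))
    · change e.val * (v * u) * e.val = e.val * (v * u)
      rw [mul_assoc, mul_assoc, h2]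
    · change e.val * (e.val * (v * u)) = e.val * (v * u)
      rw [← mul_assoc, e.idem]
  have a2 : RFree ⟨g, u, h⟩ := by
    refine RFree.gen _ (Or.inr (Or.inr ⟨⟨e.val * v, u, ⟨?_, ?_⟩, ?_, ?_⟩, rfl⟩))
    · rw [mul_assoc, mul_assoc, ← mul_assoc u, h2, ← mul_assoc v, hv2]
    · rw [← mul_assoc, h2, hv1]
    · exact mul_assoc _ _ _
    · rw [← mul_assoc, h2]
  have a3 : RFree ⟨h, h.val, f⟩ := by
    refine RFree.gen _ (Or.inl ⟨rfl, ?_⟩)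
    change f.val * (u * v) = u * v
    rw [← mul_assoc, h1]
  have := RFree.comp _ _ (RFree.comp _ _ a1 a2 (GreenR.refl _)) a3 (GreenR.refl _)
  simpa only [ug, hu] using this

/-- The morphism `l(e, u, f)` of `R_G`, for `u ∈ f S e`. -/
def RG.l {a b : RG S} (e : Idem S) (u : S) (f : Idem S) (h1 : f.val * u = u) (h2 : u * e.val = u)
    (ha : RG.of e = a) (hb : RG.of f = b) : a ⟶ b :=
  Quotient.mk (rSimSetoid a b) ⟨⟨e, u, f⟩, rFree_of_mem e u f h1 h2, ha, hb⟩

theorem RG.l_eq_iff {a b : RG S} {e : Idem S} {u : S} {f : Idem S} {h1 : f.val * u = u}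
    {h2 : u * e.val = u} {ha : RG.of e = a} {hb : RG.of f = b}
    {g : Idem S} {v : S} {h : Idem S} {h3 : h.val * v = v}
    {h4 : v * g.val = v} {ha' : RG.of g = a} {hb' : RG.of h = b} :
    RG.l e u f h1 h2 ha hb = RG.l g v h h3 h4 ha' hb' ↔ u = v * e.val := by
  constructor
  · intro h
    exact (Quotient.exact (s := rSimSetoid a b) h).2.2
  · intro h
    exact Quotient.sound (s := rSimSetoid a b) ⟨RG.of_eq_iff.1 (ha.trans ha'.symm),
      RG.of_eq_iff.1 (hb.trans hb'.symm), h⟩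

theorem RG.l_comp {a b c : RG S} {e : Idem S} {u : S} {f : Idem S} {h1 : f.val * u = u}
    {h2 : u * e.val = u} {ha : RG.of e = a} {hb : RG.of f = b}
    {g : Idem S} {v : S} {h : Idem S} {h3 : h.val * v = v}
    {h4 : v * g.val = v} {hb' : RG.of g = b} {hc : RG.of h = c} :
    RG.l e u f h1 h2 ha hb ≫ RG.l g v h h3 h4 hb' hc =
      RG.l e (v * u) h (by rw [← mul_assoc, h3]) (by rw [mul_assoc, h2]) ha hc := rfl

theorem RG.id_eq {a : RG S} (e : Idem S) (ha : RG.of e = a) :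
    𝟙 a = RG.l e e.val e e.idem e.idem ha ha :=
  Quotient.sound (s := rSimSetoid a a) ⟨RG.of_eq_iff.1 ((Quotient.out_eq a).trans ha.symm),
    RG.of_eq_iff.1 ((Quotient.out_eq a).trans ha.symm),
    (RG.of_eq_iff.1 ((Quotient.out_eq a).trans ha.symm)).1.symm⟩

theorem RG.exists_l {a b : RG S} (φ : a ⟶ b) (e f : Idem S) (ha : RG.of e = a)
    (hb : RG.of f = b) : ∃ (u : S) (h1 : f.val * u = u) (h2 : u * e.val = u),
      φ = RG.l e u f h1 h2 ha hb := by
  obtain ⟨t, rfl⟩ := Quotient.exists_rep (s := rSimSetoid a b) φ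
  have k1 := RG.of_eq_iff.1 (ha.trans t.2.2.1.symm)
  have k2 := RG.of_eq_iff.1 (hb.trans t.2.2.2.symm)
  refine ⟨t.1.elt * e.val, ?_, by rw [mul_assoc, e.idem], ?_⟩
  · rw [← mul_assoc, ← t.2.1.elt_mem.1, ← mul_assoc f.val, k2.2]
  · refine Quotient.sound (s := rSimSetoid a b) ⟨k1.symm, k2.symm, ?_⟩
    change t.1.elt = t.1.elt * e.val * t.1.dom.val
    rw [mul_assoc, k1.2, t.2.1.elt_mem.2]

theorem RG.isIncl_l_iff {a b : RG S} {e : Idem S} {u : S} {f : Idem S} {h1 : f.val * u = u}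
    {h2 : u * e.val = u} {ha : RG.of e = a} {hb : RG.of f = b} :
    RG.IsIncl (RG.l e u f h1 h2 ha hb) ↔ u = e.val := by
  constructor
  · rintro ⟨t, ⟨ht, -⟩, h⟩
    have h' := Quotient.exact (s := rSimSetoid a b) h.symm
    have := h'.2.2
    change u = t.1.elt * e.val at this
    rw [this, ht]
    exact h'.1.1
  · rintro rfl
    exact ⟨⟨⟨e, e.val, f⟩, rFree_of_mem _ _ _ h1 h2, ha, hb⟩, ⟨rfl, h1⟩, rfl⟩

instance : CategoryWithSubobjects (RG S) where
  Incl φ := RG.IsIncl φ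
  id_mem a := by
    obtain ⟨e, rfl⟩ := RG.exists_rep a
    rw [RG.id_eq e rfl, RG.isIncl_l_iff]
  comp_mem {a b c} φ ψ hφ hψ := by
    obtain ⟨e, rfl⟩ := RG.exists_rep a
    obtain ⟨f, rfl⟩ := RG.exists_rep b
    obtain ⟨g, rfl⟩ := RG.exists_rep c
    obtain ⟨u, h1, h2, rfl⟩ := RG.exists_l φ e f rfl rfl
    obtain ⟨v, h3, h4, rfl⟩ := RG.exists_l ψ f g rfl rfl
    rw [RG.isIncl_l_iff] at hφ hψ
    rw [RG.l_comp, RG.isIncl_l_iff, hψ, h1, hφ]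
  unique {a b} φ ψ hφ hψ := by
    obtain ⟨e, rfl⟩ := RG.exists_rep a
    obtain ⟨f, rfl⟩ := RG.exists_rep b
    obtain ⟨u, h1, h2, rfl⟩ := RG.exists_l φ e f rfl rfl
    obtain ⟨v, h3, h4, rfl⟩ := RG.exists_l ψ e f rfl rfl
    rw [RG.isIncl_l_iff] at hφ hψ
    rw [RG.l_eq_iff, h4, hφ, hψ]
  antisymm {a b} φ ψ hφ hψ := by
    obtain ⟨e, rfl⟩ := RG.exists_rep a
    obtain ⟨f, rfl⟩ := RG.exists_rep b
    obtain ⟨u, h1, h2, rfl⟩ := RG.exists_l φ e f rfl rfl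
    obtain ⟨v, h3, h4, rfl⟩ := RG.exists_l ψ f e rfl rfl
    rw [RG.isIncl_l_iff] at hφ hψ
    rw [hφ] at h1
    rw [hψ] at h3
    exact RG.of_eq_iff.2 ⟨h1, h3⟩
  mono {a b} φ hφ := by
    obtain ⟨e, rfl⟩ := RG.exists_rep a
    obtain ⟨f, rfl⟩ := RG.exists_rep b
    obtain ⟨u, h1, h2, rfl⟩ := RG.exists_l φ e f rfl rfl
    rw [RG.isIncl_l_iff] at hφ
    refine ⟨fun {c} ψ χ h => ?_⟩
    obtain ⟨g, rfl⟩ := RG.exists_rep c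
    obtain ⟨v, h3, h4, rfl⟩ := RG.exists_l ψ g e rfl rfl
    obtain ⟨w, h5, h6, rfl⟩ := RG.exists_l χ g e rfl rfl
    rw [RG.l_comp, RG.l_comp, RG.l_eq_iff, hφ, h3, h5] at h
    exact RG.l_eq_iff.2 h
  left_mem {a b c} φ ψ hψ h := by
    obtain ⟨e, rfl⟩ := RG.exists_rep a
    obtain ⟨f, rfl⟩ := RG.exists_rep b
    obtain ⟨g, rfl⟩ := RG.exists_rep c
    obtain ⟨u, h1, h2, rfl⟩ := RG.exists_l φ e f rfl rfl
    obtain ⟨v, h3, h4, rfl⟩ := RG.exists_l ψ f g rfl rfl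
    rw [RG.l_comp, RG.isIncl_l_iff] at h
    rw [RG.isIncl_l_iff] at hψ ⊢
    rwa [hψ, h1] at h

end RG

/-! ### The functor `Γ_G` -/

section Gamma

variable {S : Type u} [Semigroup S] [IsRegularSemigroup S]

theorem principalCone_comp (e g : Idem S) :
    (principalCone e).comp (LG.of g) = LG.r g (g.val * e.val) e
      (by rw [← mul_assoc, g.idem]) (by rw [mul_assoc, e.idem]) rfl rfl :=
  principalComp_eq e g rfl

theorem Hobj_principalCone_eq {e f : Idem S} (h : GreenR e f) :
    Hobj (principalCone e) = Hobj (principalCone f) := by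
  refine Hobj_eq _ _ (LG.r e (e.val * f.val) f (by rw [← mul_assoc, e.idem])
    (by rw [mul_assoc, f.idem]) rfl rfl) (LG.r f (f.val * e.val) e
    (by rw [← mul_assoc, f.idem]) (by rw [mul_assoc, e.idem]) rfl rfl) ?_ ?_
  · intro a
    obtain ⟨g, rfl⟩ := LG.exists_rep a
    rw [principalCone_comp, principalCone_comp]
    change LG.r _ _ _ _ _ _ _ ≫ LG.r _ _ _ _ _ _ _ = _
    rw [LG.r_comp, LG.r_eq_iff, h.2, mul_assoc, h.2]
    rw [← mul_assoc, g.idem]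
  · intro a
    obtain ⟨g, rfl⟩ := LG.exists_rep a
    rw [principalCone_comp, principalCone_comp]
    change LG.r _ _ _ _ _ _ _ ≫ LG.r _ _ _ _ _ _ _ = _
    rw [LG.r_comp, LG.r_eq_iff, h.1, mul_assoc, h.1]
    rw [← mul_assoc, g.idem]

/-- The object map of `Γ_G`: the image of `e` in `E/R` is mapped to `H(r^e; -)`. -/
noncomputable def gammaObj (a : RG S) : NormalDual (LG S) :=
  Quotient.lift (s := rSetoid S) (fun e => Hobj (principalCone e))
    (fun _ _ h => Hobj_principalCone_eq h) a

theorem gammaObj_eq {a : RG S} (e : Idem S) (h : RG.of e = a) :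
    gammaObj a = Hobj (principalCone e) := by
  subst h
  rfl

/-- `Γ_G(l(e, u, f)) = η_{r^e} L_G(r(f, u, e), -) η_{r^f}⁻¹`, as a morphism from `H(r^e; -)` to
`H(r^f; -)`. -/
noncomputable def gammaTriple (t : Triple S) (ht : RFree t) :
    Hobj (principalCone t.dom) ⟶ Hobj (principalCone t.cod) :=
  Hmap (principalCone t.dom) (principalCone t.cod)
    (LG.r t.cod t.elt t.dom ht.elt_mem.1 ht.elt_mem.2 rfl rfl)

theorem gammaTriple_app (t : Triple S) (ht : RFree t) (e : Idem S)
    {c : LG S} (g : LG.of e ⟶ c) (α : Hset (principalCone t.dom) c)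
    (hα : (α : NormalCone (LG S)) = (principalCone e).starEpi g) (f : Idem S)
    (hf : GreenR f t.cod) (v : S) (h1 : f.val * v = v) (h2 : v * e.val = v)
    (hv : v = t.elt * e.val) :
    (NormalDual.app (gammaTriple t ht) c α : NormalCone (LG S)) =
      (principalCone f).starEpi (LG.r f v e h1 h2 rfl rfl ≫ g) := by
  obtain ⟨_, g', rfl⟩ := α
  refine (Hmap_app (principalCone t.dom) (principalCone t.cod) _ g' _).trans ?_
  have hg := (starEpi_eq_iff _ _ _ _).1 hα (LG.of t.dom)
  have e1 : (principalCone t.dom).comp (LG.of t.dom) = 𝟙 (LG.of t.dom) := principalComp_self _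
  rw [e1] at hg
  have hg' : g' = (principalCone e).comp (LG.of t.dom) ≫ g := by
    rw [← hg]; exact (Category.id_comp _).symm
  rw [principalCone_comp] at hg'
  rw [starEpi_eq_iff]
  intro k
  obtain ⟨x, rfl⟩ := LG.exists_rep k
  rw [hg', principalCone_comp, principalCone_comp]
  change LG.r _ _ _ _ _ _ _ ≫ LG.r _ _ _ _ _ _ _ ≫ LG.r _ _ _ _ _ _ _ ≫ g =
    LG.r _ _ _ _ _ _ _ ≫ LG.r _ _ _ _ _ _ _ ≫ g
  simp only [← Category.assoc, LG.r_comp]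
  congr 1
  rw [LG.r_eq_iff]
  have e2 : f.val * t.elt = t.elt := by
    rw [← ht.elt_mem.1, ← mul_assoc, hf.2]
  have e3 : t.elt * (t.dom.val * e.val) = t.elt * e.val := by
    rw [← mul_assoc, ht.elt_mem.2]
  simp only [hv, mul_assoc]
  rw [e3, ← mul_assoc t.cod.val, ht.elt_mem.1, ← mul_assoc f.val, e2, ← mul_assoc x.val x.val,
    x.idem]

theorem gammaTriple_congr {a b : RG S} (s t : RPre a b) (h : RSim s.1 t.1) :
    eqToHom (gammaObj_eq s.1.dom s.2.2.1) ≫ gammaTriple s.1 s.2.1 ≫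
        eqToHom (gammaObj_eq s.1.cod s.2.2.2).symm =
      eqToHom (gammaObj_eq t.1.dom t.2.2.1) ≫ gammaTriple t.1 t.2.1 ≫
        eqToHom (gammaObj_eq t.1.cod t.2.2.2).symm := by
  obtain ⟨s, hs, rfl, rfl⟩ := s
  obtain ⟨t, ht, ht1, ht2⟩ := t
  refine NormalDual.hom_ext' fun c α => ?_
  rw [NormalDual.app_comp, NormalDual.app_comp, NormalDual.app_comp, NormalDual.app_comp,
    NormalDual.app_eqToHom, NormalDual.app_eqToHom]
  have e1 := NormalDual.app_eqToHom (gammaObj_eq t.dom ht1) c α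
  have e2 := NormalDual.app_eqToHom (gammaObj_eq s.dom rfl) c α
  obtain ⟨g, hg⟩ : ∃ g : LG.of s.dom ⟶ c, (principalCone s.dom).starEpi g = α := α.2
  have k1 : s.cod.val * s.elt = s.elt := hs.elt_mem.1
  have k2 : s.elt * s.dom.val = s.elt := hs.elt_mem.2
  refine (gammaTriple_app s hs s.dom g _ (e2.trans hg.symm) s.cod (GreenR.refl _) s.elt k1 k2
    k2.symm).trans ?_
  exact (gammaTriple_app t ht s.dom g _ (e1.trans hg.symm) s.cod h.2.1 s.elt k1 k2 h.2.2).symm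

/-- The morphism map of `Γ_G`. -/
noncomputable def gammaMap {a b : RG S} (φ : a ⟶ b) : gammaObj a ⟶ gammaObj b :=
  Quotient.lift (s := rSimSetoid a b)
    (fun t : RPre a b => eqToHom (gammaObj_eq t.1.dom t.2.2.1) ≫ gammaTriple t.1 t.2.1 ≫
      eqToHom (gammaObj_eq t.1.cod t.2.2.2).symm)
    gammaTriple_congr φ

theorem gammaMap_l (e : Idem S) (u : S) (f : Idem S) (h1 : f.val * u = u) (h2 : u * e.val = u) :
    gammaMap (RG.l e u f h1 h2 rfl rfl) =
      Hmap (principalCone e) (principalCone f) (LG.r f u e h1 h2 rfl rfl) := by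
  change 𝟙 _ ≫ Hmap (principalCone e) (principalCone f) _ ≫ 𝟙 _ = _
  rw [Category.id_comp, Category.comp_id]

/-- The functor `Γ_G : R_G ⥤ N*L_G`. -/
noncomputable def gammaG (S : Type u) [Semigroup S] [IsRegularSemigroup S] :
    RG S ⥤ NormalDual (LG S) where
  obj a := gammaObj a
  map φ := gammaMap φ
  map_id a := by
    obtain ⟨e, rfl⟩ := RG.exists_rep a
    rw [RG.id_eq e rfl, gammaMap_l, ← LG.id_eq e rfl]
    refine NormalDual.hom_ext' fun c α => ?_
    obtain ⟨_, g, rfl⟩ := α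
    refine (Hmap_app _ _ _ g _).trans ?_
    rw [Category.id_comp]
    rfl
  map_comp {a b c} φ ψ := by
    obtain ⟨e, rfl⟩ := RG.exists_rep a
    obtain ⟨f, rfl⟩ := RG.exists_rep b
    obtain ⟨g, rfl⟩ := RG.exists_rep c
    obtain ⟨u, h1, h2, rfl⟩ := RG.exists_l φ e f rfl rfl
    obtain ⟨v, h3, h4, rfl⟩ := RG.exists_l ψ f g rfl rfl
    rw [RG.l_comp, gammaMap_l, gammaMap_l, gammaMap_l, ← LG.r_comp (h1 := h3) (h2 := h4)
      (h3 := h1) (h4 := h2) (hb := rfl) (hb' := rfl)]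
    refine NormalDual.hom_ext' fun c α => ?_
    obtain ⟨_, k, rfl⟩ := α
    refine (Hmap_app _ _ _ k _).trans ?_
    change _ = (NormalDual.app (Hmap (principalCone f) (principalCone g)
      (LG.r g v f h3 h4 rfl rfl)) c (NormalDual.app (Hmap (principalCone e) (principalCone f)
        (LG.r f u e h1 h2 rfl rfl)) c ⟨(principalCone e).starEpi k, k, rfl⟩) :
          NormalCone (LG S))
    have e1 : NormalDual.app (Hmap (principalCone e) (principalCone f)
        (LG.r f u e h1 h2 rfl rfl)) c ⟨(principalCone e).starEpi k, k, rfl⟩ =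
        ⟨(principalCone f).starEpi (LG.r f u e h1 h2 rfl rfl ≫ k), _, rfl⟩ :=
      Subtype.ext (Hmap_app _ _ _ k _)
    refine Eq.trans ?_ (congrArg (fun z => (NormalDual.app (Hmap (principalCone f)
      (principalCone g) (LG.r g v f h3 h4 rfl rfl)) c z : NormalCone (LG S))) e1.symm)
    refine Eq.trans ?_ (Hmap_app _ _ _ _ _).symm
    rw [Category.assoc]

end Gamma

end CrossConn

namespace CrossConn

open CategoryWithSubobjects

/-! ### Morphisms of the normal dual -/

section Dual

variable {C : Type u} [SmallCategory C] [CategoryWithSubobjects C] [IsNormalCategory C]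

/-! Everything rests on the Yoneda lemma. Since $H(\gamma;-)\cong\mathcal C(c_\gamma,-)$, every
morphism $H(\gamma;-)\to H(\delta;-)$ of the normal dual is `Hmap γ δ r` for exactly one $r\colon
c_\delta\to c_\gamma$, and composition is reversed. Such a morphism is an inclusion exactly when
$\delta(k)r=\gamma(k)$ for all objects $k$ (`isIncl_Hmap_iff`). These two facts turn every question
about $N^*\mathcal C$ into one about morphisms and cones of $\mathcal C$.

The dual is normal for any normal $\mathcal C$: a factorization $r=quj$ read backwards factors `Hmap
γ δ r`, with the inclusion $j$ giving the retraction and the retraction $q$ giving the inclusion.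
The cones come from idempotent cones $\varepsilon$, that is, those with
$\varepsilon(c_\varepsilon)=1$. The normality of $\mathcal R_G$ is a computation in $S$, dual to
that for $\mathcal L_G$.

The functor $\Gamma_G$ is fully faithful because the morphisms $\overrightarrow e\to\overrightarrow
f$ of $\mathcal R_G$ and the morphisms $\overleftarrow f\to\overleftarrow e$ of $\mathcal L_G$ are
both indexed by $fSe$; the rest is Yoneda.

On objects $\Gamma_G$ need not be injective: in a left zero semigroup ($xy=x$) all the objects of
$\mathcal R_G$ have the same image. What $H(r^e;-)\subseteq H(r^f;-)$ gives is only $ge=gfe$ for all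
idempotents $g$. Inside an ideal there is an idempotent $g$ acting on the left as an identity on
both $e$ and $f$, which yields $e=fe$ (`gammaG_obj_injOn_ideal`). Surjectivity onto the ideal of
$H(r^h;-)$ holds because an inclusion $H(\gamma;-)\subseteq H(r^h;-)$ comes from a split epimorphism
out of $\overleftarrow h$, and the splitting produces an idempotent $e\,\omega^r h$ with
$H(r^e;-)=H(\gamma;-)$ (`exists_isSub_gammaG_obj_eq`). -/

theorem Hmap_app_of_eq (γ δ : NormalCone C) (r : δ.apex ⟶ γ.apex) {c : C} (f : γ.apex ⟶ c)
    (x : ((Hobj γ).obj.obj c).carrier) (hx : (x : NormalCone C) = γ.starEpi f) :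
    (NormalDual.app (Hmap γ δ r) c x : NormalCone C) = δ.starEpi (r ≫ f) := by
  obtain ⟨x, h⟩ := x
  obtain rfl : x = γ.starEpi f := hx
  exact Hmap_app γ δ r f h

theorem Hmap_comp (γ δ ε : NormalCone C) (r : δ.apex ⟶ γ.apex) (s : ε.apex ⟶ δ.apex) :
    Hmap γ δ r ≫ Hmap δ ε s = Hmap γ ε (s ≫ r) := by
  refine NormalDual.hom_ext' fun c x => ?_
  obtain ⟨f, hf⟩ : ∃ f, γ.starEpi f = x := x.2
  rw [NormalDual.app_comp, Hmap_app_of_eq γ ε _ f x hf.symm,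
    Hmap_app_of_eq δ ε s (r ≫ f) _ (Hmap_app_of_eq γ δ r f x hf.symm), Category.assoc]

theorem Hmap_id (γ : NormalCone C) : Hmap γ γ (𝟙 γ.apex) = 𝟙 (Hobj γ) := by
  refine NormalDual.hom_ext' fun c x => ?_
  obtain ⟨f, hf⟩ : ∃ f, γ.starEpi f = x := x.2
  rw [NormalDual.app_id, Hmap_app_of_eq γ γ _ f x hf.symm, Category.id_comp, hf]

theorem Hmap_injective (γ δ : NormalCone C) : Function.Injective (Hmap γ δ) := by
  intro r s h
  have hm : γ.starEpi (𝟙 γ.apex) ∈ Hset γ γ.apex := ⟨_, rfl⟩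
  have h1 := Hmap_app γ δ r (𝟙 _) hm
  rw [h, Hmap_app γ δ s (𝟙 _) hm, Category.comp_id, Category.comp_id] at h1
  exact (starEpi_injective δ _ h1).symm

/-- Yoneda: the element $\gamma*1^\circ$ generates $H(\gamma;-)$, since $H(\gamma;f)$ sends it to
$\gamma*f^\circ$. Its image under $t$ has the form $\delta*r^\circ$, and naturality forces $t$ to be
the morphism given by this $r$. -/
theorem Hmap_surjective (γ δ : NormalCone C) : Function.Surjective (Hmap γ δ) := by
  intro t
  have hm : γ.starEpi (𝟙 γ.apex) ∈ Hset γ γ.apex := ⟨_, rfl⟩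
  obtain ⟨r, hr⟩ : ∃ r : δ.apex ⟶ γ.apex,
      δ.starEpi r = NormalDual.app t γ.apex ⟨γ.starEpi (𝟙 γ.apex), hm⟩ :=
    (NormalDual.app t γ.apex ⟨γ.starEpi (𝟙 γ.apex), hm⟩).2
  refine ⟨r, NormalDual.hom_ext' fun c x => ?_⟩
  obtain ⟨f, hf⟩ : ∃ f, γ.starEpi f = x := x.2
  rw [Hmap_app_of_eq γ δ r f x hf.symm]
  have e1 := NormalDual.app_naturality t f ⟨γ.starEpi (𝟙 γ.apex), hm⟩
  have e2 : ((Hobj γ).obj.map f : Hset γ γ.apex → Hset γ c) ⟨γ.starEpi (𝟙 γ.apex), hm⟩ = x :=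
    Subtype.ext (by
      refine (Hfunctor_map_starEpi γ (𝟙 _) f).trans ?_
      rw [Category.id_comp, hf])
  have e3 : NormalDual.app t γ.apex ⟨γ.starEpi (𝟙 γ.apex), hm⟩ = ⟨δ.starEpi r, r, rfl⟩ :=
    Subtype.ext hr.symm
  refine (Hfunctor_map_starEpi δ r f).symm.trans ?_
  refine Eq.trans ?_ (congrArg (fun z => (NormalDual.app t c z : NormalCone C)) e2)
  refine Eq.trans ?_ (congrArg Subtype.val e1).symm
  exact congrArg (fun z => (((Hobj δ).obj.map f : Hset δ γ.apex → Hset δ c) z : NormalCone C))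
    e3.symm

/-- Being an inclusion means $\delta*(rf)^\circ=\gamma*f^\circ$ for all $f$, and such cones agree as
soon as their components do after inclusion into the codomain of $f$. The case $f=1$ gives the
criterion, and composing with $f$ recovers the general case. -/
theorem isIncl_Hmap_iff (γ δ : NormalCone C) (r : δ.apex ⟶ γ.apex) :
    Incl (Hmap γ δ r) ↔ ∀ k, δ.comp k ≫ r = γ.comp k := by
  constructor
  · intro h k
    have hm : γ.starEpi (𝟙 γ.apex) ∈ Hset γ γ.apex := ⟨_, rfl⟩
    have h1 : (NormalDual.app (Hmap γ δ r) γ.apex ⟨γ.starEpi (𝟙 γ.apex), hm⟩ : NormalCone C) =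
      γ.starEpi (𝟙 γ.apex) := h _ _
    rw [Hmap_app, starEpi_eq_iff] at h1
    simpa only [Category.comp_id] using h1 k
  · intro h c x
    obtain ⟨f, hf⟩ : ∃ f, γ.starEpi f = x := x.2
    rw [Hmap_app_of_eq γ δ r f x hf.symm, ← hf, starEpi_eq_iff]
    intro k
    rw [← Category.assoc, h]

theorem isIso_Hmap (γ δ : NormalCone C) (r : δ.apex ⟶ γ.apex) [IsIso r] : IsIso (Hmap γ δ r) :=
  ⟨Hmap δ γ (inv r), by rw [Hmap_comp, IsIso.inv_hom_id, Hmap_id],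
    by rw [Hmap_comp, IsIso.hom_inv_id, Hmap_id]⟩

/-! ### Idempotent cones and the normality of the dual. -/

theorem NormalDual.exists_Hobj (F : NormalDual C) : ∃ γ : NormalCone C, Hobj γ = F := by
  obtain ⟨_, γ, rfl⟩ := F
  exact ⟨γ, rfl⟩

/-- Every `H`-functor comes from an idempotent cone. -/
theorem NormalDual.exists_idempotent_cone (F : NormalDual C) :
    ∃ γ : NormalCone C, Hobj γ = F ∧ γ.comp γ.apex = 𝟙 γ.apex := by
  obtain ⟨γ, rfl⟩ := F.exists_Hobj
  obtain ⟨c, i, h1, h2⟩ := γ.isNormal.exists_isIso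
  have : Epi i := (SplitEpi.mk (γ.comp c) h1).epi
  -- Shifting $\gamma$ along the inverse $i$ of its invertible component $\gamma(c)$ moves the apex
  -- to $c$ and makes the component there $\gamma(c)i=1$; an isomorphism of apices does not change
  -- the $H$-functor.
  refine ⟨γ.star i, Hobj_eq _ _ (γ.comp c) i ?_ fun a => rfl, h1⟩
  intro a
  exact (Category.assoc _ _ _).trans ((congrArg _ h2).trans (Category.comp_id _))

/-- The morphism `F ⟶ H(ε; -)` which is `Hmap γ ε (γ(c_ε))` for any cone `γ` with
`F = H(γ; -)`. -/
noncomputable def dualConeComp (ε : NormalCone C) (F : NormalDual C) : F ⟶ Hobj ε :=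
  eqToHom F.exists_Hobj.choose_spec.symm ≫
    Hmap F.exists_Hobj.choose ε (F.exists_Hobj.choose.comp ε.apex)

/-- The composite $\gamma(c_\varepsilon)f$ is the component of the cone $x$ at $c_\varepsilon$
followed by an inclusion, so it depends on $x$ and $c$ alone and the chosen representative of $F$ is
irrelevant. The cone $\gamma$ need not represent $F$; only the presentation of the single element
$x$ matters. -/
theorem dualConeComp_app (ε : NormalCone C) (F : NormalDual C) {c : C}
    (x : (F.obj.obj c).carrier) (γ : NormalCone C) (f : γ.apex ⟶ c)
    (hx : (x : NormalCone C) = γ.starEpi f) :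
    (NormalDual.app (dualConeComp ε F) c x : NormalCone C) = ε.starEpi (γ.comp ε.apex ≫ f) := by
  have e1 := NormalDual.app_eqToHom F.exists_Hobj.choose_spec.symm c x
  unfold dualConeComp
  rw [NormalDual.app_comp]
  generalize NormalDual.app (eqToHom F.exists_Hobj.choose_spec.symm) c x = y at e1 ⊢
  obtain ⟨g, hg⟩ : ∃ g, F.exists_Hobj.choose.starEpi g = y := y.2
  rw [Hmap_app_of_eq _ ε _ g y hg.symm]
  rw [← e1, ← hg, starEpi_eq_iff] at hx
  rw [hx]

/-- An inclusion fixes every element, and the components act on an element by a rule that does not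
see the functor containing it. -/
theorem incl_comp_dualConeComp (ε : NormalCone C) {F G : NormalDual C} (j : F ⟶ G)
    (hj : Incl j) : j ≫ dualConeComp ε G = dualConeComp ε F := by
  obtain ⟨γ, rfl⟩ := F.exists_Hobj
  refine NormalDual.hom_ext' fun c x => ?_
  obtain ⟨f, hf⟩ : ∃ f, γ.starEpi f = x := x.2
  rw [NormalDual.app_comp, dualConeComp_app ε G _ γ f ((hj c x).trans hf.symm),
    dualConeComp_app ε _ _ γ f hf.symm]

theorem dualConeComp_self (ε : NormalCone C) (h : ε.comp ε.apex = 𝟙 ε.apex) :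
    dualConeComp ε (Hobj ε) = 𝟙 (Hobj ε) := by
  refine NormalDual.hom_ext' fun c x => ?_
  obtain ⟨f, hf⟩ : ∃ f, ε.starEpi f = x := x.2
  rw [NormalDual.app_id, dualConeComp_app ε _ _ ε f hf.symm, h, Category.id_comp, hf]

/-- A factorization `r = q v j` of a morphism between apices yields a normal factorization of the
corresponding morphism of the normal dual. -/
theorem nonempty_normalFactorization_Hmap (γ γ' δ δ' : NormalCone C) {r : δ.apex ⟶ γ.apex}
    (q : δ.apex ⟶ δ'.apex) (v : δ'.apex ⟶ γ'.apex) (j : γ'.apex ⟶ γ.apex)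
    (p : γ.apex ⟶ γ'.apex) (hv : IsIso v) (hp : j ≫ p = 𝟙 _)
    (hγ : ∀ k, γ.comp k ≫ p = γ'.comp k) (hδ : ∀ k, δ.comp k ≫ q = δ'.comp k)
    (fac : q ≫ v ≫ j = r) : Nonempty (NormalFactorization (Hmap γ δ r)) := by
  refine ⟨⟨Hobj γ', Hobj δ', Hmap γ γ' j, Hmap γ' δ' v, Hmap δ' δ q,
    ⟨Hmap γ' γ p, (isIncl_Hmap_iff _ _ _).2 hγ, ?_⟩, isIso_Hmap _ _ _,
    (isIncl_Hmap_iff _ _ _).2 hδ, ?_⟩⟩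
  · rw [Hmap_comp, hp, Hmap_id]
  · rw [Hmap_comp, Hmap_comp, Category.assoc, fac]

/-- The normal dual of a normal category is a normal category. -/
theorem isNormalCategory_normalDual : IsNormalCategory (NormalDual C) where
  exists_factorization {F G} t := by
    obtain ⟨γ, rfl⟩ := F.exists_Hobj
    obtain ⟨δ, rfl⟩ := G.exists_Hobj
    obtain ⟨r, rfl⟩ := Hmap_surjective γ δ t
    obtain ⟨⟨d', c', q, v, j, ⟨i, hi, hiq⟩, hv, hj, fac⟩⟩ :=
      IsNormalCategory.exists_factorization r
    -- The intermediate functors belong to $\gamma*p$ and $\delta*q$. A splitting $p$ of $j$ is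
    -- needed to move $\gamma$ to the smaller apex, whereas $q$ already does this for $\delta$.
    obtain ⟨p, hp⟩ := IsNormalCategory.incl_splits j hj
    have : Epi p := (SplitEpi.mk j hp).epi
    have : Epi q := (SplitEpi.mk i hiq).epi
    exact nonempty_normalFactorization_Hmap γ (γ.star p) δ (δ.star q) q v j p hv hp
      (fun _ => rfl) (fun _ => rfl) fac
  incl_splits {F G} j hj := by
    obtain ⟨γ, rfl⟩ := F.exists_Hobj
    obtain ⟨δ, rfl⟩ := G.exists_Hobj
    obtain ⟨r, rfl⟩ := Hmap_surjective γ δ j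
    obtain ⟨c, hc⟩ := γ.isNormal.exists_isIso
    -- Since $\delta(c)r=\gamma(c)$ is invertible for a suitable $c$, the morphism
    -- $\gamma(c)^{-1}\delta(c)$ is a section of $r$; contravariance turns it into a retraction of
    -- the inclusion.
    refine ⟨Hmap δ γ (inv (γ.comp c) ≫ δ.comp c), ?_⟩
    rw [Hmap_comp, Category.assoc, (isIncl_Hmap_iff _ _ _).1 hj, IsIso.inv_hom_id, Hmap_id]
  exists_cone F := by
    obtain ⟨ε, rfl, hε⟩ := F.exists_idempotent_cone
    refine ⟨dualConeComp ε, ⟨incl_comp_dualConeComp ε, Hobj ε, ?_⟩, dualConeComp_self ε hε⟩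
    rw [dualConeComp_self ε hε]
    infer_instance

end Dual

/-! ### The category `R_G` is normal -/

section RG

variable {S : Type u} [Semigroup S] [IsRegularSemigroup S]

/-- The components `l(g, e g, e)` of the principal cone of an idempotent `e` in `R_G`. -/
noncomputable def RG.principalComp (e : Idem S) (a : RG S) : a ⟶ RG.of e :=
  RG.l a.out (e.val * a.out.val) e (by rw [← mul_assoc, e.idem])
    (by rw [mul_assoc, a.out.idem]) (Quotient.out_eq a) rfl

theorem RG.principalComp_eq (e g : Idem S) {a : RG S} (ha : RG.of g = a) :
    RG.principalComp e a = RG.l g (e.val * g.val) e (by rw [← mul_assoc, e.idem])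
      (by rw [mul_assoc, g.idem]) ha rfl := by
  refine RG.l_eq_iff.2 ?_
  rw [mul_assoc, (RG.of_eq_iff.1 ((Quotient.out_eq a).trans ha.symm)).1]

theorem RG.principalComp_self (e : Idem S) : RG.principalComp e (RG.of e) = 𝟙 (RG.of e) := by
  rw [RG.principalComp_eq e e rfl, RG.id_eq e rfl, RG.l_eq_iff]

theorem RG.isNormalCone_principalComp (e : Idem S) : IsNormalCone (RG.principalComp e) := by
  refine ⟨fun {a b} j hj => ?_, RG.of e, ?_⟩
  · obtain ⟨f, rfl⟩ := RG.exists_rep a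
    obtain ⟨g, rfl⟩ := RG.exists_rep b
    obtain ⟨w, h1, h2, rfl⟩ := RG.exists_l j f g rfl rfl
    have hj' : w = f.val := RG.isIncl_l_iff.1 hj
    rw [RG.principalComp_eq e f rfl, RG.principalComp_eq e g rfl, RG.l_comp, RG.l_eq_iff,
      mul_assoc, h1, hj', mul_assoc, f.idem]
  · rw [RG.principalComp_self]; infer_instance

/-- Left-right dual of the argument for $\mathcal L_G$: an inverse $v$ of $w\in fSe$ splits
$l(e,w,f)$ as $l(e,g,g)\,l(g,w,h)\,l(h,h,f)$ with $g\,\mathscr L\,w\,\mathscr R\,h$, and the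
required cones are given by left multiplication by an idempotent. -/
theorem isNormalCategory_RG : IsNormalCategory (RG S) where
  exists_factorization {a b} φ := by
    obtain ⟨e, rfl⟩ := RG.exists_rep a
    obtain ⟨f, rfl⟩ := RG.exists_rep b
    obtain ⟨w, h1, h2, rfl⟩ := RG.exists_l φ e f rfl rfl
    obtain ⟨v, hv1, hv2⟩ := IsRegularSemigroup.exists_inverse w
    have i1 : (e.val * (v * w)) * (e.val * (v * w)) = e.val * (v * w) := by
      rw [show (e.val * (v * w)) * (e.val * (v * w)) = e.val * (v * (w * e.val * v * w)) by
        simp only [mul_assoc], h2, hv1]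
    have i2 : w * v * (w * v) = w * v := by rw [← mul_assoc, hv1]
    -- The idempotent $vw$ need not lie below $e$, as a retraction requires; since $we=w$,
    -- multiplying by $e$ on the left corrects this. No correction is needed for $wv$, because an
    -- inclusion only asks for $wv\,\omega^r f$. The pair $(w,ev)$ is again mutually inverse.
    obtain ⟨g, hg⟩ : ∃ g : Idem S, g.val = e.val * (v * w) := ⟨⟨_, i1⟩, rfl⟩
    obtain ⟨h, hh⟩ : ∃ h : Idem S, h.val = w * v := ⟨⟨_, i2⟩, rfl⟩
    have wg : w * g.val = w := by rw [hg, ← mul_assoc, h2, ← mul_assoc, hv1]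
    have hw : h.val * w = w := by rw [hh, hv1]
    have ge : g.val * e.val = g.val := by rw [hg, mul_assoc, mul_assoc, h2]
    have eg : e.val * g.val = g.val := by rw [hg, ← mul_assoc, e.idem]
    have fh : f.val * h.val = h.val := by rw [hh, ← mul_assoc, h1]
    have w1 : e.val * v * h.val = e.val * v := by rw [hh, mul_assoc, ← mul_assoc v, hv2]
    have w2 : g.val * (e.val * v) = e.val * v := by
      rw [← mul_assoc, ge, hg, mul_assoc, hv2]
    refine ⟨⟨RG.of g, RG.of h, RG.l e g.val g g.idem ge rfl rfl, RG.l g w h hw wg rfl rfl,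
      RG.l h h.val f fh h.idem rfl rfl, ⟨RG.l g g.val e eg g.idem rfl rfl, ?_, ?_⟩, ?_, ?_, ?_⟩⟩
    · exact RG.isIncl_l_iff.2 rfl
    · rw [RG.l_comp, RG.id_eq g rfl, RG.l_eq_iff]
    · refine ⟨RG.l h (e.val * v) g w2 w1 rfl rfl, ?_, ?_⟩
      · rw [RG.l_comp, RG.id_eq g rfl, RG.l_eq_iff, g.idem, hg, mul_assoc]
      · rw [RG.l_comp, RG.id_eq h rfl, RG.l_eq_iff, h.idem, hh, ← mul_assoc, h2]
    · exact RG.isIncl_l_iff.2 rfl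
    · rw [RG.l_comp, RG.l_comp, RG.l_eq_iff, h2, hw, wg]
  incl_splits {a b} j hj := by
    obtain ⟨e, rfl⟩ := RG.exists_rep a
    obtain ⟨f, rfl⟩ := RG.exists_rep b
    obtain ⟨w, h1, h2, rfl⟩ := RG.exists_l j e f rfl rfl
    obtain rfl : w = e.val := RG.isIncl_l_iff.1 hj
    -- Here $fe=e$, so $e\cdot ef\cdot e$ reduces to $e$ and $l(f,ef,e)$ retracts the inclusion.
    refine ⟨RG.l f (e.val * f.val) e (by rw [← mul_assoc, e.idem]) (by rw [mul_assoc, f.idem])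
      rfl rfl, ?_⟩
    rw [RG.l_comp, RG.id_eq e rfl, RG.l_eq_iff, mul_assoc, h1]
  exists_cone a := by
    obtain ⟨e, rfl⟩ := RG.exists_rep a
    exact ⟨RG.principalComp e, RG.isNormalCone_principalComp e, RG.principalComp_self e⟩

end RG

/-! ### `Γ_G` is a local isomorphism -/

section Gamma

variable {S : Type u} [Semigroup S] [IsRegularSemigroup S]

/-- If $fe=e$, then $r^f(\overleftarrow g)\,r(f,e,e)=r(g,gfe,e)=r(g,ge,e)=r^e(\overleftarrow g)$,
which is the inclusion criterion. -/
theorem inclusionPreserving_gammaG : InclusionPreserving (gammaG S) := by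
  intro a b j hj
  obtain ⟨e, rfl⟩ := RG.exists_rep a
  obtain ⟨f, rfl⟩ := RG.exists_rep b
  obtain ⟨w, h1, h2, rfl⟩ := RG.exists_l j e f rfl rfl
  obtain rfl : w = e.val := RG.isIncl_l_iff.1 hj
  change Incl (gammaMap _)
  rw [gammaMap_l]
  refine (isIncl_Hmap_iff _ _ _).2 fun k => ?_
  obtain ⟨g, rfl⟩ := LG.exists_rep k
  rw [principalCone_comp, principalCone_comp]
  change LG.r _ _ _ _ _ _ _ ≫ LG.r _ _ _ _ _ _ _ = _
  rw [LG.r_comp, LG.r_eq_iff, mul_assoc, h1, ← mul_assoc, g.idem]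

/-- By Yoneda a morphism of $H$-functors is some $r(f,w,e)$ with $w\in fSe$, and the same $w$
defines $l(e,w,f)$. -/
theorem full_gammaG : (gammaG S).Full where
  map_surjective {a b} t := by
    obtain ⟨e, rfl⟩ := RG.exists_rep a
    obtain ⟨f, rfl⟩ := RG.exists_rep b
    obtain ⟨r, hr⟩ := Hmap_surjective (principalCone e) (principalCone f) t
    obtain ⟨w, h1, h2, rfl⟩ := LG.exists_r r f e rfl rfl
    exact ⟨RG.l e w f h1 h2 rfl rfl, (gammaMap_l e w f h1 h2).trans hr⟩

theorem faithful_gammaG : (gammaG S).Faithful where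
  map_injective {a b} φ ψ h := by
    obtain ⟨e, rfl⟩ := RG.exists_rep a
    obtain ⟨f, rfl⟩ := RG.exists_rep b
    obtain ⟨w, h1, h2, rfl⟩ := RG.exists_l φ e f rfl rfl
    obtain ⟨v, h3, h4, rfl⟩ := RG.exists_l ψ e f rfl rfl
    have h' := Hmap_injective _ _
      ((gammaMap_l e w f h1 h2).symm.trans (h.trans (gammaMap_l e v f h3 h4)))
    rw [LG.r_eq_iff, h3] at h'
    rw [RG.l_eq_iff, h4, h']

/-! ### Bijectivity on the objects of ideals. -/

/-- If `H(r^e; -) ⊆ H(r^f; -)`, then `g e = g f e` for all idempotents `g`. -/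
theorem mul_eq_of_isSub_Hobj {e f : Idem S}
    (h : IsSub (Hobj (principalCone e)) (Hobj (principalCone f))) (g : Idem S) :
    g.val * e.val = g.val * (f.val * e.val) := by
  obtain ⟨j, hj⟩ := h
  obtain ⟨r, rfl⟩ := Hmap_surjective _ _ j
  obtain ⟨w, h1, h2, rfl⟩ := LG.exists_r r f e rfl rfl
  have key : ∀ x : Idem S, x.val * e.val = x.val * w := by
    intro x
    have hx := (isIncl_Hmap_iff _ _ _).1 hj (LG.of x)
    rw [principalCone_comp, principalCone_comp] at hx
    change LG.r _ _ _ _ _ _ _ ≫ LG.r _ _ _ _ _ _ _ = _ at hx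
    rw [LG.r_comp, LG.r_eq_iff, mul_assoc, h1, ← mul_assoc x.val x.val, x.idem] at hx
    exact hx.symm
  -- The relation is used for the idempotents $g$ and $f$: the latter gives $fe=fw=w$, which
  -- identifies $w$.
  rw [key, key, h1]

/-- The common upper bound $g$ satisfies $ge=e$ and $gf=f$, so the relation $ge=gfe$ can be
cancelled to $e=fe$; exchanging $e$ and $f$ gives $e\,\mathscr R\,f$. -/
theorem gammaG_obj_injOn_ideal {a b c : RG S} (ha : IsSub a c) (hb : IsSub b c)
    (h : (gammaG S).obj a = (gammaG S).obj b) : a = b := by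
  have key : ∀ {e f g : Idem S}, IsSub (RG.of e) (RG.of g) → IsSub (RG.of f) (RG.of g) →
      Hobj (principalCone e) = Hobj (principalCone f) → OmegaR e f := by
    rintro e f g ⟨i, hi⟩ ⟨j, hj⟩ h
    obtain ⟨w, h1, h2, rfl⟩ := RG.exists_l i e g rfl rfl
    obtain rfl : w = e.val := RG.isIncl_l_iff.1 hi
    obtain ⟨v, h3, h4, rfl⟩ := RG.exists_l j f g rfl rfl
    obtain rfl : v = f.val := RG.isIncl_l_iff.1 hj
    have hs : IsSub (Hobj (principalCone e)) (Hobj (principalCone f)) := by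
      rw [h]
      exact ⟨𝟙 _, id_mem _⟩
    have := mul_eq_of_isSub_Hobj hs g
    rw [h1, ← mul_assoc, h3] at this
    exact this.symm
  obtain ⟨e, rfl⟩ := RG.exists_rep a
  obtain ⟨f, rfl⟩ := RG.exists_rep b
  obtain ⟨g, rfl⟩ := RG.exists_rep c
  exact RG.of_eq_iff.2 ⟨key ha hb h, key hb ha h.symm⟩

/-- The inclusion comes from some $r=r(h,w,f)$ with a section $r(f,v,h)$, so $vw=f$. Then $wv$ is an
idempotent below $h$ in $\omega^r$, and its principal cone differs from $\gamma$ only by an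
isomorphism of apices. -/
theorem exists_isSub_gammaG_obj_eq {c : RG S} {F : NormalDual (LG S)}
    (hF : IsSub F ((gammaG S).obj c)) : ∃ a : RG S, IsSub a c ∧ (gammaG S).obj a = F := by
  obtain ⟨h, rfl⟩ := RG.exists_rep c
  obtain ⟨γ, rfl⟩ := F.exists_Hobj
  obtain ⟨j, hj⟩ := hF
  obtain ⟨r, rfl⟩ := Hmap_surjective γ (principalCone h) j
  have hr := (isIncl_Hmap_iff _ _ _).1 hj
  obtain ⟨f, hf⟩ := LG.exists_rep γ.apex
  obtain ⟨c, hc⟩ := γ.isNormal.exists_isIso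
  obtain ⟨s, hs⟩ : ∃ s : γ.apex ⟶ LG.of h, s ≫ r = 𝟙 γ.apex := by
    -- The inclusion criterion $r^h(c)r=\gamma(c)$ at an invertible component makes
    -- $\gamma(c)^{-1}r^h(c)$ a section of $r$.
    refine ⟨inv (γ.comp c) ≫ (principalCone h).comp c, ?_⟩
    have := hr c
    rw [Category.assoc, IsIso.inv_comp_eq, Category.comp_id]
    exact this
  obtain ⟨w, h1, h2, rfl⟩ := LG.exists_r r h f rfl hf
  obtain ⟨v, h3, h4, rfl⟩ := LG.exists_r s f h hf rfl
  rw [LG.r_comp, LG.id_eq f hf, LG.r_eq_iff, f.idem] at hs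
  have i : w * v * (w * v) = w * v := by
    rw [mul_assoc, ← mul_assoc v, hs, h3]
  obtain ⟨e, he⟩ : ∃ e : Idem S, e.val = w * v := ⟨⟨_, i⟩, rfl⟩
  have ew : e.val * w = w := by rw [he, mul_assoc, hs, h2]
  have ve : v * e.val = v := by rw [he, ← mul_assoc, hs, h3]
  have hce : h.val * e.val = e.val := by rw [he, ← mul_assoc, h1]
  have hγ : ∀ x : Idem S, γ.comp (LG.of x) = LG.r x (x.val * w) f
      (by rw [← mul_assoc, x.idem]) (by rw [mul_assoc, h2]) rfl hf := by
    intro x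
    rw [← hr (LG.of x), principalCone_comp]
    change LG.r _ _ _ _ _ _ _ ≫ LG.r _ _ _ _ _ _ _ = _
    rw [LG.r_comp, LG.r_eq_iff, mul_assoc, h1, ← mul_assoc, x.idem]
  refine ⟨RG.of e, ⟨RG.l e e.val h hce e.idem rfl rfl, RG.isIncl_l_iff.2 rfl⟩, ?_⟩
  -- The elements $w$ and $v$ give mutually inverse isomorphisms between $\overleftarrow e$ and the
  -- apex of $\gamma$, because $wv=e$ and $vw=f$. They exchange the components $xe$ of $r^e$ and
  -- $xw$ of $\gamma$.
  refine Hobj_eq (principalCone e) γ (LG.r e w f ew h2 rfl hf) (LG.r f v e h3 ve hf rfl) ?_ ?_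
  · intro a
    obtain ⟨x, rfl⟩ := LG.exists_rep a
    rw [principalCone_comp, hγ]
    change LG.r _ _ _ _ _ _ _ ≫ LG.r _ _ _ _ _ _ _ = _
    rw [LG.r_comp, LG.r_eq_iff, mul_assoc, ew, ← mul_assoc, x.idem]
  · intro a
    obtain ⟨x, rfl⟩ := LG.exists_rep a
    rw [principalCone_comp, hγ, LG.r_comp, LG.r_eq_iff, he, mul_assoc, ← mul_assoc x.val x.val,
      x.idem]

/-- Ideals are full subcategories, so full faithfulness is inherited from $\Gamma_G$ and only the
bijection on objects needs the two preceding results. -/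
theorem isCategoryIso_restrictIdeal_gammaG (c : RG S) :
    IsCategoryIso (restrictIdeal (gammaG S) inclusionPreserving_gammaG c) := by
  have := full_gammaG (S := S)
  have := faithful_gammaG (S := S)
  refine ⟨⟨?_, ?_⟩, ?_, ?_⟩
  · rintro ⟨a, ha⟩ ⟨b, hb⟩ h
    obtain rfl := gammaG_obj_injOn_ideal ha hb (congrArg ObjectProperty.FullSubcategory.obj h)
    rfl
  · rintro ⟨F, hF⟩
    obtain ⟨a, ha, rfl⟩ := exists_isSub_gammaG_obj_eq hF
    exact ⟨⟨a, ha⟩, rfl⟩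
  · unfold restrictIdeal
    infer_instance
  · unfold restrictIdeal
    infer_instance

end Gamma

end CrossConn

theorem mainTheorem5 (S : Type*) [Semigroup S] [CrossConn.IsRegularSemigroup S] :
    CrossConn.IsLocalIsomorphism (CrossConn.gammaG S) where
  normal_source := CrossConn.isNormalCategory_RG
  normal_target := CrossConn.isNormalCategory_normalDual
  inclusionPreserving := CrossConn.inclusionPreserving_gammaG
  full := CrossConn.full_gammaG
  faithful := CrossConn.faithful_gammaG
  iso_on_ideals := CrossConn.isCategoryIso_restrictIdeal_gammaG
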